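/- Let $\mathbb B_n=\{z\in\mathbb C^n:|z|<1\}$ be the open unit ball of $\mathbb C^n$, with $\langle z,w\rangle=\sum_k z_k\overline{w_k}$ and $|z|=\langle z,z\rangle^{1/2}$, and let $dv$ be the normalized volume measure on $\mathbb B_n$. For $\alpha>-1$ let $dv_\alpha(z)=c_\alpha(1-|z|^2)^\alpha\,dv(z)$, where $c_\alpha>0$ is chosen so that $v_\alpha(\mathbb B_n)=1$. For $p>0$ let $A^p_\alpha(\mathbb B_n)=L^p(\mathbb B_n,dv_\alpha)\cap H(\mathbb B_n)$, where $H(\mathbb B_n)$ is the space of holomorphic functions on $\mathbb B_n$. For $a\in\mathbb B_n$ let $\varphi_a$ be the involutive automorphism of $\mathbb B_n$ exchanging $0$ and $a$, $$\varphi_a(z)=\frac{a-P_az-\sqrt{1-|a|^2}\,(z-P_az)}{1-\langle z,a\rangle},$$ where $P_a$ is the orthogonal projection of $\mathbb C^n$ onto $\mathbb Ca$ (so $P_0=0$). Put $\rho(z,w)=|\varphi_z(w)|$ and $\beta(z,w)=\frac12\log\frac{1+\rho(z,w)}{1-\rho(z,w)}$ for $z,w\in\mathbb B_n$. Suppose $p>0$,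 $\alpha>-1$, and $f\in H(\mathbb B_n)$. Then the following conditions are equivalent. (a) $f$ belongs to $A^p_\alpha(\mathbb B_n)$. (b) There exists a continuous function $g\in L^p(\mathbb B_n,dv_\alpha)$ such that $|f(z)-f(w)|\le\rho(z,w)(g(z)+g(w))$ for all $z,w\in\mathbb B_n$. (c) There exists a continuous function $g\in L^p(\mathbb B_n,dv_\alpha)$ such that $|f(z)-f(w)|\le\beta(z,w)(g(z)+g(w))$ for all $z,w\in\mathbb B_n$. (d) There exists a continuous function $g\in L^p(\mathbb B_n,dv_{p+\alpha})$ such that $|f(z)-f(w)|\le|z-w|(g(z)+g(w))$ for all $z,w\in\mathbb B_n$. -/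

import Mathlib

open MeasureTheory Metric

/-- The space `ℂⁿ` with its Euclidean (Hermitian) norm. -/
abbrev CSpace (n : ℕ) : Type := EuclideanSpace ℂ (Fin n)

/-- The open unit ball `𝔹ₙ` of `ℂⁿ`. -/
def unitBall (n : ℕ) : Set (CSpace n) := ball 0 1

/-- Normalized volume measure `v` on `𝔹ₙ`, regarded as a measure on `ℂⁿ` carried by `𝔹ₙ`. -/
noncomputable def ballVolume (n : ℕ) : Measure (CSpace n) :=
  (volume (unitBall n))⁻¹ • volume.restrict (unitBall n)

/-- The measure `(1 - |z|²)^α dv(z)`, before normalization. -/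
noncomputable def weightedVolumeAux (n : ℕ) (α : ℝ) : Measure (CSpace n) :=
  (ballVolume n).withDensity fun z => ENNReal.ofReal ((1 - ‖z‖ ^ 2) ^ α)

/-- The weighted volume measure `dv_α(z) = c_α (1 - |z|²)^α dv(z)`, where `c_α` is the reciprocal of
the total mass of `(1 - |z|²)^α dv(z)` (which is positive and finite for `α > -1`). -/
noncomputable def weightedVolume (n : ℕ) (α : ℝ) : Measure (CSpace n) :=
  (weightedVolumeAux n α Set.univ)⁻¹ • weightedVolumeAux n α

/-- Membership in the weighted Bergman space `A^p_α(𝔹ₙ) = L^p(𝔹ₙ, dv_α) ∩ H(𝔹ₙ)`.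
Only the values of `f` on `𝔹ₙ` matter. -/
def MemBergman (n : ℕ) (p α : ℝ) (f : CSpace n → ℂ) : Prop :=
  DifferentiableOn ℂ f (unitBall n) ∧ MemLp f (ENNReal.ofReal p) (weightedVolume n α)

/-- The involutive automorphism `φ_a` of `𝔹ₙ`:
`φ_a(z) = (a - P_a z - (1 - |a|²)^{1/2} (z - P_a z)) / (1 - ⟨z, a⟩)`, where
`⟨z, a⟩ = ∑ z_k conj(a_k)`, which is `inner ℂ a z` in Mathlib's convention, and
`P_a z = (⟨z, a⟩ / |a|²) a` is the orthogonal projection onto `ℂ a` (so that `P_0 = 0`). -/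
noncomputable def ballInvolution {n : ℕ} (a z : CSpace n) : CSpace n :=
  let P : CSpace n := (inner ℂ a z / (‖a‖ : ℂ) ^ 2) • a
  (1 - inner ℂ a z)⁻¹ • (a - P - ((√(1 - ‖a‖ ^ 2) : ℝ) : ℂ) • (z - P))

/-- The pseudo-hyperbolic metric `ρ(z, w) = |φ_z(w)|` on `𝔹ₙ`. -/
noncomputable def pseudoHyp {n : ℕ} (z w : CSpace n) : ℝ := ‖ballInvolution z w‖

/-- The Bergman metric `β(z, w) = (1/2) log ((1 + |φ_z(w)|) / (1 - |φ_z(w)|))` on `𝔹ₙ`. -/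
noncomputable def bergmanDist {n : ℕ} (z w : CSpace n) : ℝ :=
  1 / 2 * Real.log ((1 + ‖ballInvolution z w‖) / (1 - ‖ballInvolution z w‖))

/-! From (a) to (b): `ballInvolution z` moves `z` to `0`, so put `F = f ∘ ballInvolution z`. A
sub-mean-value estimate for `|F|^p` bounds `|F|` on `|u| ≤ 1/2` by some `A z`, and the Schwarz lemma
gives `|f z - f w| ≤ 4 A(z) ρ(z,w)` when `ρ < 1/2`. When `ρ ≥ 1/2`, the bound `|f| ≤ A` suffices. To
make `A` continuous and `p`-integrable, `A^p` is taken to be `(1-|z|²)^(-α)` times the average of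
`|f|^p (1-|u|²)^α` against the Jacobian `J(u,z)` of `ballInvolution u` at `z`. Since `∫ J(u,z) dz`
is the volume of the ball for every `u`, Tonelli's theorem gives integrability
(`exists_continuousOn_pseudoHyp_bound`).

From (b) follow (c), because `ρ ≤ β`, and (d), because `ρ ≤ |z-w|/(1-|z|)` and symmetrically in `w`.

From (c) or (d) back to (a), no derivative is needed. On a ray, compare `f` at distances `t` and
`Kt` from the sphere. Both conditions bound the difference by `G` at the two points, with `G` in the
weighted space of exponent `α`. Scaling by `K` costs `K^(-(1+α))`, so for large `K` the term at `Kt`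
is absorbed: this is the Hardy inequality `lintegral_rpow_le_of_le_comp_mul`, applied on each ray in
polar coordinates. -/

/-! ### Algebra and Jacobian of the ball involutions. -/

section Involution

variable {n : ℕ}

lemma sqrt_one_sub_sq_pos {a : CSpace n} (ha : ‖a‖ < 1) : 0 < √(1 - ‖a‖ ^ 2) :=
  Real.sqrt_pos.2 (by nlinarith [norm_nonneg a])

lemma inner_self_eq_one_sub {a : CSpace n} (ha : ‖a‖ < 1) :
    inner ℂ a a = 1 - ((√(1 - ‖a‖ ^ 2) : ℝ) : ℂ) ^ 2 := by
  rw [inner_self_eq_norm_sq_to_K, ← Complex.ofReal_pow,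
    Real.sq_sqrt (by nlinarith [norm_nonneg a])]
  simp

lemma one_add_sqrt_ne_zero (a : CSpace n) : (1 + ((√(1 - ‖a‖ ^ 2) : ℝ) : ℂ)) ≠ 0 := by
  have : (0 : ℝ) < 1 + √(1 - ‖a‖ ^ 2) := by positivity
  exact_mod_cast this.ne'

lemma one_sub_norm_le {a z : CSpace n} (hz : ‖z‖ ≤ 1) : 1 - ‖a‖ ≤ ‖1 - inner ℂ a z‖ := by
  have h1 : ‖inner ℂ a z‖ ≤ ‖a‖ * ‖z‖ := norm_inner_le_norm a z
  have h2 : ‖a‖ * ‖z‖ ≤ ‖a‖ := mul_le_of_le_one_right (norm_nonneg a) hz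
  have h3 : ‖(1 : ℂ)‖ - ‖inner ℂ a z‖ ≤ ‖1 - inner ℂ a z‖ := norm_sub_norm_le _ _
  rw [norm_one] at h3
  linarith

lemma one_sub_inner_ne_zero {a z : CSpace n} (ha : ‖a‖ < 1) (hz : ‖z‖ ≤ 1) :
    1 - inner ℂ a z ≠ 0 :=
  norm_pos_iff.1 ((sub_pos.2 ha).trans_le (one_sub_norm_le hz))

/-- The linear part of the numerator of `ballInvolution a`. -/
noncomputable def involutionLinear (a : CSpace n) : CSpace n →L[ℂ] CSpace n :=
  ((√(1 - ‖a‖ ^ 2) : ℝ) : ℂ) • ContinuousLinearMap.id ℂ (CSpace n) +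
    (1 + ((√(1 - ‖a‖ ^ 2) : ℝ) : ℂ))⁻¹ • (innerSL ℂ a).smulRight a

lemma involutionLinear_apply (a z : CSpace n) :
    involutionLinear a z = ((√(1 - ‖a‖ ^ 2) : ℝ) : ℂ) • z +
      ((1 + ((√(1 - ‖a‖ ^ 2) : ℝ) : ℂ))⁻¹ * inner ℂ a z) • a := by
  simp [involutionLinear, smul_smul]

/-- With `s² = 1-|a|²` one has `(1-s)/|a|² = 1/(1+s)`. This removes the division by `|a|²`, so `a =
0` needs no separate treatment afterwards. -/
lemma ballInvolution_eq {a : CSpace n} (ha : ‖a‖ < 1) (z : CSpace n) :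
    ballInvolution a z = (1 - inner ℂ a z)⁻¹ • (a - involutionLinear a z) := by
  rw [ballInvolution, involutionLinear_apply]
  congr 1
  have hs := one_add_sqrt_ne_zero a
  have hsa := inner_self_eq_one_sub ha
  rw [inner_self_eq_norm_sq_to_K] at hsa
  rcases eq_or_ne a 0 with rfl | h0
  · simp
  have hna : (‖a‖ : ℂ) ^ 2 ≠ 0 := by simpa using h0
  have key : (1 + ((√(1 - ‖a‖ ^ 2) : ℝ) : ℂ))⁻¹ * inner ℂ a z
      = (1 - ((√(1 - ‖a‖ ^ 2) : ℝ) : ℂ)) * (inner ℂ a z / (‖a‖ : ℂ) ^ 2) := by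
    have : (‖a‖ : ℂ) ^ 2 = 1 - ((√(1 - ‖a‖ ^ 2) : ℝ) : ℂ) ^ 2 := hsa
    rw [mul_div_assoc', eq_div_iff hna, this]
    field_simp
    ring
  rw [key]
  module

/-- The linear part is `P_a + s (1 - P_a)`: the identity on `ℂ a` and multiplication by `s` on its
orthogonal complement. This is behind the next lemmas on `involutionLinear`, including its square
and its norm. -/
lemma inner_involutionLinear {a : CSpace n} (ha : ‖a‖ < 1) (z : CSpace n) :
    inner ℂ a (involutionLinear a z) = inner ℂ a z := by
  rw [involutionLinear_apply, inner_add_right, inner_smul_right, inner_smul_right,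
    inner_self_eq_one_sub ha]
  have hs := one_add_sqrt_ne_zero a
  field_simp
  ring

lemma involutionLinear_self {a : CSpace n} (ha : ‖a‖ < 1) : involutionLinear a a = a := by
  rw [involutionLinear_apply, inner_self_eq_one_sub ha, ← add_smul]
  have hs := one_add_sqrt_ne_zero a
  convert one_smul ℂ a using 2
  field_simp
  ring

lemma involutionLinear_involutionLinear {a : CSpace n} (ha : ‖a‖ < 1) (z : CSpace n) :
    involutionLinear a (involutionLinear a z) =
      ((√(1 - ‖a‖ ^ 2) : ℝ) : ℂ) ^ 2 • z + inner ℂ a z • a := by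
  conv_lhs => rw [involutionLinear_apply a z]
  rw [map_add, map_smul, map_smul, involutionLinear_self ha, involutionLinear_apply]
  have hs := one_add_sqrt_ne_zero a
  have key : inner ℂ a z = (((√(1 - ‖a‖ ^ 2) : ℝ) : ℂ) + 1) *
      ((1 + ((√(1 - ‖a‖ ^ 2) : ℝ) : ℂ))⁻¹ * inner ℂ a z) := by
    field_simp
    ring
  conv_rhs => rw [key]
  module

lemma ballInvolution_zero {a : CSpace n} (ha : ‖a‖ < 1) : ballInvolution a 0 = a := by
  simp [ballInvolution_eq ha]

lemma inner_ballInvolution {a z : CSpace n} (ha : ‖a‖ < 1) (hz : ‖z‖ ≤ 1) :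
    1 - inner ℂ a (ballInvolution a z) =
      ((√(1 - ‖a‖ ^ 2) : ℝ) : ℂ) ^ 2 / (1 - inner ℂ a z) := by
  have h := one_sub_inner_ne_zero ha hz
  rw [ballInvolution_eq ha, inner_smul_right, inner_sub_right, inner_involutionLinear ha,
    inner_self_eq_one_sub ha]
  field_simp
  ring

lemma ballInvolution_ballInvolution {a z : CSpace n} (ha : ‖a‖ < 1) (hz : ‖z‖ ≤ 1) :
    ballInvolution a (ballInvolution a z) = z := by
  have h := one_sub_inner_ne_zero ha hz
  have hs : ((√(1 - ‖a‖ ^ 2) : ℝ) : ℂ) ≠ 0 := by exact_mod_cast (sqrt_one_sub_sq_pos ha).ne'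
  rw [ballInvolution_eq ha (ballInvolution a z), inner_ballInvolution ha hz,
    ballInvolution_eq ha z, map_smul, map_sub, involutionLinear_self ha,
    involutionLinear_involutionLinear ha]
  have : a - (1 - inner ℂ a z)⁻¹ • (a - (((√(1 - ‖a‖ ^ 2) : ℝ) : ℂ) ^ 2 • z + inner ℂ a z • a))
      = ((1 - inner ℂ a z)⁻¹ * ((√(1 - ‖a‖ ^ 2) : ℝ) : ℂ) ^ 2) • z := by
    have : a = ((1 - inner ℂ a z)⁻¹ * (1 - inner ℂ a z)) • a := by
      rw [inv_mul_cancel₀ h, one_smul]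
    nth_rewrite 1 [this]
    module
  rw [this, smul_smul]
  convert one_smul ℂ z using 2
  field_simp

lemma norm_involutionLinear_sq {a : CSpace n} (ha : ‖a‖ < 1) (z : CSpace n) :
    ‖involutionLinear a z‖ ^ 2 = (1 - ‖a‖ ^ 2) * ‖z‖ ^ 2 + ‖inner ℂ a z‖ ^ 2 := by
  set s : ℝ := √(1 - ‖a‖ ^ 2) with hs
  have hs2 : s ^ 2 = 1 - ‖a‖ ^ 2 := Real.sq_sqrt (by nlinarith [norm_nonneg a])
  have hs0 : 0 < 1 + s := by positivity
  have e : ((1 + (s : ℂ))⁻¹ * inner ℂ a z) = (((1 + s)⁻¹ : ℝ) : ℂ) * inner ℂ a z := by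
    push_cast; rfl
  rw [involutionLinear_apply, ← hs, e, @norm_add_sq ℂ, norm_smul, norm_smul, norm_mul,
    inner_smul_left, inner_smul_right, Complex.conj_ofReal, Complex.norm_real, Complex.norm_real,
    ← inner_conj_symm z a]
  have e2 : (s : ℂ) * (((1 + s)⁻¹ : ℝ) * inner ℂ a z * (starRingEnd ℂ) (inner ℂ a z))
      = ((s * (1 + s)⁻¹ * ‖inner ℂ a z‖ ^ 2 : ℝ) : ℂ) := by
    rw [mul_assoc, Complex.mul_conj, Complex.normSq_eq_norm_sq]; push_cast; ring
  rw [e2, RCLike.re_eq_complex_re, Complex.ofReal_re, Real.norm_of_nonneg (Real.sqrt_nonneg _),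
    Real.norm_of_nonneg (inv_nonneg.2 hs0.le), ← hs]
  have : ‖a‖ ^ 2 = (1 - s) * (1 + s) := by linarith
  rw [← hs2]
  simp only [mul_pow, this]
  field_simp
  ring

/-- Expanding the numerator gives `|a - Lz|² = |1-⟨z,a⟩|² - (1-|a|²)(1-|z|²)`, where `L` is the
linear part. -/
lemma one_sub_norm_ballInvolution_sq {a z : CSpace n} (ha : ‖a‖ < 1) (hz : ‖z‖ ≤ 1) :
    1 - ‖ballInvolution a z‖ ^ 2 =
      (1 - ‖a‖ ^ 2) * (1 - ‖z‖ ^ 2) / ‖1 - inner ℂ a z‖ ^ 2 := by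
  have h := norm_pos_iff.2 (one_sub_inner_ne_zero ha hz)
  rw [ballInvolution_eq ha, norm_smul, norm_inv, mul_pow, @norm_sub_sq ℂ,
    norm_involutionLinear_sq ha, inner_involutionLinear ha]
  field_simp
  rw [@norm_sub_sq_real ℂ, Complex.inner]
  simp
  ring

lemma norm_ballInvolution_lt_one {a z : CSpace n} (ha : ‖a‖ < 1) (hz : ‖z‖ < 1) :
    ‖ballInvolution a z‖ < 1 := by
  have h := norm_pos_iff.2 (one_sub_inner_ne_zero ha hz.le)
  have h1 := one_sub_norm_ballInvolution_sq ha hz.le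
  have h2 : 0 < (1 - ‖a‖ ^ 2) * (1 - ‖z‖ ^ 2) / ‖1 - inner ℂ a z‖ ^ 2 := by
    have : 0 < 1 - ‖a‖ ^ 2 := by nlinarith [norm_nonneg a]
    have : 0 < 1 - ‖z‖ ^ 2 := by nlinarith [norm_nonneg z]
    positivity
  nlinarith [norm_nonneg (ballInvolution a z)]

/-- By the preceding identity and Cauchy–Schwarz. It is the source of every comparison of `ρ` with
the Euclidean distance. -/
lemma norm_ballInvolution_le {a z : CSpace n} (ha : ‖a‖ < 1) (hz : ‖z‖ ≤ 1) :
    ‖ballInvolution a z‖ ≤ ‖a - z‖ / ‖1 - inner ℂ a z‖ := by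
  have h := norm_pos_iff.2 (one_sub_inner_ne_zero ha hz)
  have h1 := one_sub_norm_ballInvolution_sq ha hz
  rw [le_div_iff₀ h]
  refine le_of_sq_le_sq ?_ (norm_nonneg _)
  rw [eq_div_iff (by positivity)] at h1
  have h2 : ‖1 - inner ℂ a z‖ ^ 2 = 1 - 2 * (inner ℂ a z).re + ‖inner ℂ a z‖ ^ 2 := by
    rw [@norm_sub_sq_real ℂ, Complex.inner]
    simp
  have h3 : ‖a - z‖ ^ 2 = ‖a‖ ^ 2 - 2 * (inner ℂ a z).re + ‖z‖ ^ 2 := by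
    rw [@norm_sub_sq ℂ]; simp
  have h4 : ‖inner ℂ a z‖ ^ 2 ≤ ‖a‖ ^ 2 * ‖z‖ ^ 2 := by
    rw [← mul_pow]; gcongr; exact norm_inner_le_norm a z
  rw [mul_pow, h3]
  nlinarith

lemma bijOn_ballInvolution {a : CSpace n} (ha : ‖a‖ < 1) :
    Set.BijOn (ballInvolution a) (unitBall n) (unitBall n) := by
  have hm : Set.MapsTo (ballInvolution a) (unitBall n) (unitBall n) := fun z hz => by
    simp only [unitBall, mem_ball_zero_iff] at hz ⊢
    exact norm_ballInvolution_lt_one ha hz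
  have hi : Set.LeftInvOn (ballInvolution a) (ballInvolution a) (unitBall n) := fun z hz => by
    simp only [unitBall, mem_ball_zero_iff] at hz
    exact ballInvolution_ballInvolution ha hz.le
  exact ⟨hm, hi.injOn, fun z hz => ⟨_, hm hz, hi hz⟩⟩

/-- The complex derivative of `ballInvolution a` at `z`. -/
noncomputable def involutionDeriv (a z : CSpace n) : CSpace n →L[ℂ] CSpace n :=
  (1 - inner ℂ a z)⁻¹ • ((innerSL ℂ a).smulRight (ballInvolution a z) - involutionLinear a)

lemma hasFDerivAt_ballInvolution {a z : CSpace n} (ha : ‖a‖ < 1) (hz : ‖z‖ ≤ 1) :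
    HasFDerivAt (ballInvolution a) (involutionDeriv a z) z := by
  have h := one_sub_inner_ne_zero ha hz
  have e : ballInvolution a = fun z => (1 - inner ℂ a z)⁻¹ • (a - involutionLinear a z) :=
    funext (ballInvolution_eq ha)
  have h1 : HasFDerivAt (fun z => 1 - innerSL ℂ a z) (-(innerSL ℂ a)) z :=
    (innerSL ℂ a).hasFDerivAt.const_sub 1
  have h2 : HasFDerivAt (fun z => a - involutionLinear a z) (-(involutionLinear a)) z :=
    (involutionLinear a).hasFDerivAt.const_sub a
  have h3 := ((hasDerivAt_inv (by simpa using h)).comp_hasFDerivAt z h1).smul h2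
  rw [e]
  refine h3.congr_fderiv ?_
  ext1 v
  rw [involutionDeriv, ballInvolution_eq ha]
  simp only [innerSL_apply_apply, add_apply, smul_apply,
    neg_apply, ContinuousLinearMap.smulRight_apply,
    sub_apply, smul_neg, neg_smul, neg_neg, smul_smul, smul_sub, smul_eq_mul,
    Function.comp_apply, ← inv_pow]
  module

/-- A rank-one perturbation of a scalar map is that scalar times a transvection. -/
lemma det_smul_id_add_smulRight (c : ℂ) (hc : c ≠ 0) (a b : CSpace n) :
    LinearMap.det ((c • ContinuousLinearMap.id ℂ (CSpace n) + (innerSL ℂ a).smulRight b :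
      CSpace n →L[ℂ] CSpace n) : CSpace n →ₗ[ℂ] CSpace n) =
      c ^ n * (1 + inner ℂ a b / c) := by
  have e : ((c • ContinuousLinearMap.id ℂ (CSpace n) + (innerSL ℂ a).smulRight b :
      CSpace n →L[ℂ] CSpace n) : CSpace n →ₗ[ℂ] CSpace n) =
      c • LinearMap.transvection ((innerSL ℂ a : CSpace n →L[ℂ] ℂ) : CSpace n →ₗ[ℂ] ℂ) (c⁻¹ • b) := by
    ext1 v
    simp [LinearMap.transvection, smul_smul, mul_comm c, hc]
  rw [e, LinearMap.det_smul, LinearMap.transvection.det]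
  simp [div_eq_inv_mul]

/-- The derivative is a scalar map plus a rank-one map, so its complex determinant has modulus
`(s/|1-⟨z,a⟩|)^(n+1)`. The real determinant is the square of this modulus. -/
lemma abs_det_involutionDeriv {a z : CSpace n} (ha : ‖a‖ < 1) (hz : ‖z‖ ≤ 1) :
    |((involutionDeriv a z).restrictScalars ℝ).det| =
      ((1 - ‖a‖ ^ 2) / ‖1 - inner ℂ a z‖ ^ 2) ^ (n + 1) := by
  have h := one_sub_inner_ne_zero ha hz
  have hs' := sqrt_one_sub_sq_pos ha
  have hs2 : √(1 - ‖a‖ ^ 2) ^ 2 = 1 - ‖a‖ ^ 2 := Real.sq_sqrt (by nlinarith [norm_nonneg a])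
  have hin := inner_ballInvolution ha hz
  have hin2 := inner_self_eq_one_sub ha
  have h1s := one_add_sqrt_ne_zero a
  set s : ℝ := √(1 - ‖a‖ ^ 2) with hsdef
  have hs : (s : ℂ) ≠ 0 := by exact_mod_cast hs'.ne'
  have e : involutionDeriv a z = (1 - inner ℂ a z)⁻¹ •
      ((-(s : ℂ)) • ContinuousLinearMap.id ℂ (CSpace n) +
        (innerSL ℂ a).smulRight (ballInvolution a z - (1 + (s : ℂ))⁻¹ • a)) := by
    ext1 v
    simp only [involutionDeriv, smul_apply, sub_apply,
      ContinuousLinearMap.smulRight_apply, innerSL_apply_apply, involutionLinear_apply,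
      add_apply, ContinuousLinearMap.id_apply, ← hsdef]
    module
  have hdet : LinearMap.det ((involutionDeriv a z : CSpace n →L[ℂ] CSpace n) :
      CSpace n →ₗ[ℂ] CSpace n) = ((1 - inner ℂ a z)⁻¹ * (-s)) ^ n * (s / (1 - inner ℂ a z)) := by
    rw [e, ContinuousLinearMap.toLinearMap_smul, LinearMap.det_smul,
      det_smul_id_add_smulRight _ (neg_ne_zero.2 hs), inner_sub_right, inner_smul_right, hin2,
      mul_pow, finrank_euclideanSpace_fin, mul_assoc]
    congr 2
    have : inner ℂ a (ballInvolution a z) = 1 - (s : ℂ) ^ 2 / (1 - inner ℂ a z) := by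
      rw [← hin]; ring
    rw [this]
    field_simp
    ring
  have hr : ((involutionDeriv a z).restrictScalars ℝ).det = Complex.normSq
      (LinearMap.det ((involutionDeriv a z : CSpace n →L[ℂ] CSpace n) :
      CSpace n →ₗ[ℂ] CSpace n)) := by
    rw [← Algebra.norm_complex_apply, ← LinearMap.det_restrictScalars]
    rfl
  rw [hr, abs_of_nonneg (Complex.normSq_nonneg _), Complex.normSq_eq_norm_sq, hdet, norm_mul,
    norm_pow, norm_mul, norm_inv, norm_neg, norm_div, Complex.norm_real,
    Real.norm_of_nonneg hs'.le, ← hs2]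
  rw [← div_eq_inv_mul, ← pow_succ, ← pow_mul, mul_comm, pow_mul, div_pow]

end Involution

/-! ### Mean value inequalities and the Schwarz lemma. -/

section SubMean

variable {n : ℕ}

lemma measurePreserving_add_smul (z : CSpace n) {c : ℂ} (hc : ‖c‖ = 1) :
    MeasurePreserving (fun u : CSpace n => z + c • u) ∧
      MeasurableEmbedding (fun u : CSpace n => z + c • u) := by
  have hc0 : c ≠ 0 := by rintro rfl; simp at hc
  let e : CSpace n ≃ₗᵢ[ℝ] CSpace n :=
    { (LinearEquiv.smulOfNeZero ℂ (CSpace n) c hc0).restrictScalars ℝ with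
      norm_map' := fun u => by
        change ‖c • u‖ = ‖u‖
        rw [norm_smul, hc, one_mul] }
  refine ⟨(measurePreserving_add_left volume z).comp e.measurePreserving, ?_⟩
  exact (MeasurableEquiv.addLeft z).measurableEmbedding.comp
    e.toHomeomorph.measurableEmbedding

/-- The one-variable mean value property holds on each circle `c ↦ z + c u`, `|c| = 1`. Integrating
over `u` and exchanging the integrals gives the volume version, since `u ↦ c u` preserves the ball
and its volume. -/
lemma enorm_mul_volume_ball_le {F : CSpace n → ℂ} {U : Set (CSpace n)}
    (hF : DifferentiableOn ℂ F U) {z : CSpace n} {δ : ℝ} (hδ : closedBall z δ ⊆ U) :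
    ‖F z‖ₑ * volume (ball z δ) ≤ ∫⁻ u in ball z δ, ‖F u‖ₑ := by
  have hcirc (θ : ℝ) : ‖circleMap 0 1 θ‖ = 1 := by simp
  have hpt : ∀ u ∈ ball (0 : CSpace n) δ, ‖F z‖ₑ * ENNReal.ofReal (2 * Real.pi) ≤
      ∫⁻ θ in Set.Ioc 0 (2 * Real.pi), ‖F (z + circleMap 0 1 θ • u)‖ₑ := by
    intro u hu
    rw [mem_ball_zero_iff] at hu
    have hd : DifferentiableOn ℂ (fun c : ℂ => F (z + c • u)) (closedBall 0 1) := by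
      refine hF.comp (by fun_prop) fun c hc => hδ ?_
      rw [mem_closedBall_zero_iff] at hc
      rw [mem_closedBall, dist_eq_norm, add_sub_cancel_left, norm_smul]
      nlinarith [norm_nonneg u]
    have h1 : Real.circleAverage (fun c : ℂ => F (z + c • u)) 0 1 = F z := by
      have h2 : DiffContOnCl ℂ (fun c : ℂ => F (z + c • u)) (ball 0 |1|) := by
        rw [abs_one]
        exact hd.diffContOnCl_ball subset_rfl
      simpa using h2.circleAverage
    rw [Real.circleAverage_def, inv_smul_eq_iff₀ (by positivity)] at h1
    have h3 : ‖F z‖ₑ * ENNReal.ofReal (2 * Real.pi) = ‖(2 * Real.pi) • F z‖ₑ := by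
      rw [enorm_smul, Real.enorm_eq_ofReal (by positivity), mul_comm]
    rw [h3, ← h1, intervalIntegral.integral_of_le (by positivity)]
    exact enorm_integral_le_lintegral_enorm _
  have hint : ∀ θ : ℝ, ∫⁻ u in ball (0 : CSpace n) δ, ‖F (z + circleMap 0 1 θ • u)‖ₑ =
      ∫⁻ u in ball z δ, ‖F u‖ₑ := by
    intro θ
    obtain ⟨h1, h2⟩ := measurePreserving_add_smul z (hcirc θ)
    rw [← h1.setLIntegral_comp_preimage_emb h2 (fun u => ‖F u‖ₑ) (ball z δ)]
    congr 2
    ext u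
    simp [dist_eq_norm, norm_smul]
  have hmeas : AEMeasurable (Function.uncurry fun (u : CSpace n) (θ : ℝ) =>
      ‖F (z + circleMap 0 1 θ • u)‖ₑ) ((volume.restrict (ball (0 : CSpace n) δ)).prod
        (volume.restrict (Set.Ioc 0 (2 * Real.pi)))) := by
    rw [Measure.prod_restrict]
    refine ContinuousOn.aemeasurable ?_ (measurableSet_ball.prod measurableSet_Ioc)
    refine continuous_enorm.comp_continuousOn (hF.continuousOn.comp ?_ ?_)
    · have := continuous_circleMap 0 1
      fun_prop
    · rintro ⟨u, θ⟩ ⟨hu, -⟩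
      refine hδ ?_
      rw [mem_ball_zero_iff] at hu
      rw [mem_closedBall, dist_eq_norm, add_sub_cancel_left, norm_smul, hcirc, one_mul]
      exact hu.le
  have hπ : ENNReal.ofReal (2 * Real.pi) ≠ 0 := by simp [Real.pi_pos]
  have hvol : volume (ball z δ) = volume (ball (0 : CSpace n) δ) :=
    Measure.addHaar_ball_center _ _ _
  have key : ‖F z‖ₑ * ENNReal.ofReal (2 * Real.pi) * volume (ball (0 : CSpace n) δ) ≤
      (∫⁻ u in ball z δ, ‖F u‖ₑ) * ENNReal.ofReal (2 * Real.pi) := by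
    calc _ = ∫⁻ u in ball (0 : CSpace n) δ, ‖F z‖ₑ * ENNReal.ofReal (2 * Real.pi) := by
          simp
      _ ≤ ∫⁻ u in ball (0 : CSpace n) δ, ∫⁻ θ in Set.Ioc 0 (2 * Real.pi),
            ‖F (z + circleMap 0 1 θ • u)‖ₑ := setLIntegral_mono' measurableSet_ball hpt
      _ = ∫⁻ θ in Set.Ioc 0 (2 * Real.pi), ∫⁻ u in ball (0 : CSpace n) δ,
            ‖F (z + circleMap 0 1 θ • u)‖ₑ := lintegral_lintegral_swap hmeas
      _ = _ := by simp [hint]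
  rw [hvol]
  refine (ENNReal.mul_le_mul_iff_left hπ ENNReal.ofReal_ne_top).1 ?_
  calc _ = _ := by ring
    _ ≤ _ := key

lemma norm_mul_volume_ball_le {F : CSpace n → ℂ} {U : Set (CSpace n)}
    (hF : DifferentiableOn ℂ F U) {z : CSpace n} {δ : ℝ} (hδ : closedBall z δ ⊆ U) :
    ‖F z‖ * volume.real (ball z δ) ≤ ∫ u in ball z δ, ‖F u‖ := by
  have hi : IntegrableOn F (ball z δ) :=
    ((hF.continuousOn.mono hδ).integrableOn_compact (isCompact_closedBall z δ)).mono_set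
      ball_subset_closedBall
  have h := enorm_mul_volume_ball_le hF hδ
  rw [← ofReal_integral_norm_eq_lintegral_enorm hi] at h
  have h2 := ENNReal.toReal_mono ENNReal.ofReal_ne_top h
  rwa [ENNReal.toReal_mul, toReal_enorm,
    ENNReal.toReal_ofReal (integral_nonneg fun _ => norm_nonneg _)] at h2

/-- Only `x ≥ m/2` matters, and there `x^(1-p)` is at most a constant times `m^(1-p)`: by the upper
bound on `x` if `p ≤ 1`, by `x ≥ m/2` if `p ≥ 1`. It turns a mean value inequality for `|F|` into
one for `|F|^p`, even when `p < 1`. -/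
lemma exists_le_half_add_rpow {p : ℝ} (hp : 0 < p) {D : ℝ} (hD : 0 < D) :
    ∃ c > 0, ∀ m > 0, ∀ x ≥ 0, x ^ p ≤ D * m ^ p → x ≤ m / 2 + c * m ^ (1 - p) * x ^ p := by
  refine ⟨max ((1 / 2) ^ (1 - p)) ((D ^ p⁻¹) ^ (1 - p)), by positivity, fun m hm x hx h => ?_⟩
  rcases hx.eq_or_lt with rfl | hx0
  · positivity
  have hxp : x = x ^ (1 - p) * x ^ p := by rw [← Real.rpow_add hx0]; simp
  rcases le_total x (m / 2) with hxm | hxm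
  · have : 0 ≤ max ((1 / 2) ^ (1 - p)) ((D ^ p⁻¹) ^ (1 - p)) * m ^ (1 - p) * x ^ p := by positivity
    linarith
  suffices x ^ (1 - p) ≤ max ((1 / 2) ^ (1 - p)) ((D ^ p⁻¹) ^ (1 - p)) * m ^ (1 - p) by
    calc x = x ^ (1 - p) * x ^ p := hxp
      _ ≤ max ((1 / 2) ^ (1 - p)) ((D ^ p⁻¹) ^ (1 - p)) * m ^ (1 - p) * x ^ p := by gcongr
      _ ≤ _ := by linarith
  rcases le_total p 1 with h1 | h1
  · have hx2 : x ≤ D ^ p⁻¹ * m := by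
      have := Real.rpow_le_rpow (by positivity) h (inv_nonneg.2 hp.le)
      rwa [Real.mul_rpow hD.le (by positivity), ← Real.rpow_mul hx, ← Real.rpow_mul hm.le,
        mul_inv_cancel₀ hp.ne', Real.rpow_one, Real.rpow_one] at this
    calc x ^ (1 - p) ≤ (D ^ p⁻¹ * m) ^ (1 - p) :=
          Real.rpow_le_rpow hx hx2 (by linarith)
      _ = (D ^ p⁻¹) ^ (1 - p) * m ^ (1 - p) := Real.mul_rpow (by positivity) hm.le
      _ ≤ _ := by gcongr; exact le_max_right _ _
  · calc x ^ (1 - p) ≤ (1 / 2 * m) ^ (1 - p) :=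
          Real.rpow_le_rpow_of_nonpos (by positivity) (by linarith) (by linarith)
      _ = (1 / 2) ^ (1 - p) * m ^ (1 - p) := Real.mul_rpow (by positivity) hm.le
      _ ≤ _ := by gcongr; exact le_max_left _ _

/-- Local `L^p` control of the supremum of a holomorphic function, for every `p > 0`. -/
lemma exists_norm_rpow_le_integral (n : ℕ) {p : ℝ} (hp : 0 < p) :
    ∃ C > 0, ∀ F : CSpace n → ℂ, DifferentiableOn ℂ F (ball 0 1) → ∀ z : CSpace n, ‖z‖ ≤ 1 / 2 →
      ‖F z‖ ^ p ≤ C * ∫ u in ball 0 (3 / 4), ‖F u‖ ^ p := by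
  set d := Module.finrank ℝ (CSpace n) with hd
  set V := volume.real (ball (0 : CSpace n) 1) with hV
  have hV0 : 0 < V := ENNReal.toReal_pos (measure_ball_pos _ _ one_pos).ne' measure_ball_lt_top.ne
  obtain ⟨c, hc, hcx⟩ := exists_le_half_add_rpow hp (D := 2 ^ d) (by positivity)
  refine ⟨4 ^ d * (2 ^ d * (2 * c / V)), by positivity, fun F hF z hz => ?_⟩
  have hsub : closedBall (0 : CSpace n) (3 / 4) ⊆ ball 0 1 := closedBall_subset_ball (by norm_num)
  have hFp : ContinuousOn (fun u => ‖F u‖ ^ p) (closedBall 0 (3 / 4)) :=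
    (hF.continuousOn.mono hsub).norm.rpow_const fun _ _ => Or.inr hp.le
  have hI : IntegrableOn (fun u => ‖F u‖ ^ p) (ball 0 (3 / 4)) :=
    (hFp.integrableOn_compact (isCompact_closedBall _ _)).mono_set ball_subset_closedBall
  set J := ∫ u in ball 0 (3 / 4), ‖F u‖ ^ p with hJ
  have hJ0 : 0 ≤ J := integral_nonneg fun _ => by positivity
  -- Maximizing `|F|^p` against a power of the distance to the boundary makes `|F|^p` at most `2^d`
  -- times its value at `z₀` on a ball of half that distance around `z₀`.
  obtain ⟨z₀, hz₀, hmax⟩ := (isCompact_closedBall (0 : CSpace n) (3 / 4)).exists_isMaxOn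
    (f := fun u => (3 / 4 - ‖u‖) ^ d * ‖F u‖ ^ p) ⟨0, mem_closedBall_self (by norm_num)⟩
    ((by fun_prop : Continuous fun u : CSpace n => (3 / 4 - ‖u‖) ^ d).continuousOn.mul hFp)
  rw [mem_closedBall_zero_iff] at hz₀
  have hmax' : ∀ u : CSpace n, ‖u‖ ≤ 3 / 4 →
      (3 / 4 - ‖u‖) ^ d * ‖F u‖ ^ p ≤ (3 / 4 - ‖z₀‖) ^ d * ‖F z₀‖ ^ p := fun u hu =>
    hmax (mem_closedBall_zero_iff.2 hu)
  have hz' : ‖F z‖ ^ p ≤ 4 ^ d * ((3 / 4 - ‖z₀‖) ^ d * ‖F z₀‖ ^ p) := by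
    have h1 := hmax' z (by linarith)
    have h2 : (1 / 4 : ℝ) ^ d ≤ (3 / 4 - ‖z‖) ^ d := by gcongr; linarith
    calc ‖F z‖ ^ p = 4 ^ d * ((1 / 4) ^ d * ‖F z‖ ^ p) := by
          rw [← mul_assoc, ← mul_pow]; norm_num
      _ ≤ 4 ^ d * ((3 / 4 - ‖z‖) ^ d * ‖F z‖ ^ p) := by gcongr
      _ ≤ _ := by gcongr
  suffices h : (3 / 4 - ‖z₀‖) ^ d * ‖F z₀‖ ^ p ≤ 2 ^ d * (2 * c / V) * J by
    calc ‖F z‖ ^ p ≤ 4 ^ d * ((3 / 4 - ‖z₀‖) ^ d * ‖F z₀‖ ^ p) := hz'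
      _ ≤ 4 ^ d * (2 ^ d * (2 * c / V) * J) := by gcongr
      _ = _ := by ring
  have hrhs : 0 ≤ 2 ^ d * (2 * c / V) * J := by positivity
  rcases (norm_nonneg (F z₀)).eq_or_lt with hm | hm
  · rw [← hm, Real.zero_rpow hp.ne', mul_zero]; exact hrhs
  set m := ‖F z₀‖ with hmdef
  -- On the boundary the weight vanishes, except that `0^d = 1` when `d = 0`; but then `z₀ = 0` is
  -- not on the boundary.
  rcases hz₀.eq_or_lt with h0 | h0
  · rcases Nat.eq_zero_or_pos d with hd0 | hd0
    · have hsubs : Subsingleton (CSpace n) := Module.finrank_zero_iff.1 (hd ▸ hd0)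
      rw [Subsingleton.elim z₀ 0, norm_zero] at h0
      norm_num at h0
    · rw [h0, sub_self, zero_pow hd0.ne', zero_mul]; exact hrhs
  set δ := (3 / 4 - ‖z₀‖) / 2 with hδ
  have hδ0 : 0 < δ := by rw [hδ]; linarith
  have hball : closedBall z₀ δ ⊆ ball 0 (3 / 4) := fun u hu => by
    rw [mem_closedBall, dist_eq_norm] at hu
    rw [mem_ball_zero_iff]
    have := norm_le_norm_add_norm_sub' u z₀
    linarith
  have hvol : volume.real (ball z₀ δ) = δ ^ d * V := by
    rw [hV, measureReal_def, Measure.addHaar_ball_of_pos _ _ hδ0, ENNReal.toReal_mul,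
      ENNReal.toReal_ofReal (by positivity), measureReal_def]
  have hmean := norm_mul_volume_ball_le hF
    (hball.trans (ball_subset_closedBall.trans hsub))
  rw [hvol] at hmean
  have hbd : ∀ u ∈ ball z₀ δ, ‖F u‖ ≤ m / 2 + c * m ^ (1 - p) * ‖F u‖ ^ p := by
    intro u hu
    refine hcx m hm _ (norm_nonneg _) ?_
    have hu' := hball (ball_subset_closedBall hu)
    rw [mem_ball_zero_iff] at hu'
    have h1 := hmax' u hu'.le
    have h2 : δ ≤ 3 / 4 - ‖u‖ := by
      rw [mem_ball, dist_eq_norm] at hu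
      have := norm_le_norm_add_norm_sub' u z₀
      linarith
    have h3 : δ ^ d * ‖F u‖ ^ p ≤ δ ^ d * (2 ^ d * m ^ p) := by
      calc δ ^ d * ‖F u‖ ^ p ≤ (3 / 4 - ‖u‖) ^ d * ‖F u‖ ^ p := by gcongr
        _ ≤ (3 / 4 - ‖z₀‖) ^ d * m ^ p := h1
        _ = (2 * δ) ^ d * m ^ p := by rw [hδ]; ring_nf
        _ = _ := by rw [mul_pow]; ring
    exact le_of_mul_le_mul_left h3 (by positivity)
  have hIb : IntegrableOn (fun u => ‖F u‖ ^ p) (ball z₀ δ) :=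
    hI.mono_set (ball_subset_closedBall.trans hball)
  have hFb : IntegrableOn (fun u => ‖F u‖) (ball z₀ δ) :=
    (((hF.continuousOn.mono (hball.trans (ball_subset_closedBall.trans hsub))).norm
      ).integrableOn_compact (isCompact_closedBall z₀ δ)).mono_set ball_subset_closedBall
  have hconst : IntegrableOn (fun _ : CSpace n => m / 2) (ball z₀ δ) :=
    integrableOn_const measure_ball_lt_top.ne
  have h4 : ∫ u in ball z₀ δ, ‖F u‖ ≤ m / 2 * (δ ^ d * V) + c * m ^ (1 - p) * J := by
    calc ∫ u in ball z₀ δ, ‖F u‖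
        ≤ ∫ u in ball z₀ δ, (m / 2 + c * m ^ (1 - p) * ‖F u‖ ^ p) :=
          setIntegral_mono_on hFb (hconst.add (hIb.const_mul _)) measurableSet_ball hbd
      _ = m / 2 * (δ ^ d * V) + c * m ^ (1 - p) * ∫ u in ball z₀ δ, ‖F u‖ ^ p := by
          rw [integral_add hconst (hIb.const_mul _), integral_const_mul, setIntegral_const, hvol,
            smul_eq_mul, mul_comm]
      _ ≤ _ := by
          gcongr
          exact setIntegral_mono_set hI (ae_of_all _ fun _ => by positivity)
            (ball_subset_closedBall.trans hball).eventuallyLE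
  -- The term `m/2` is absorbed on the left, which leaves `m^p |B| ≤ 2 c J` after division by
  -- `m^(1-p)`, with `|B|` the volume of the small ball.
  have h5 : m * (δ ^ d * V) ≤ m * (2 * c * m ^ (-p) * J) := by
    have : m ^ (1 - p) = m * m ^ (-p) := by
      rw [sub_eq_add_neg, Real.rpow_add hm, Real.rpow_one]
    rw [this] at h4
    nlinarith
  have h6 := le_of_mul_le_mul_left h5 hm
  have hmp : m ^ (-p) * m ^ p = 1 := by rw [← Real.rpow_add hm]; simp
  calc (3 / 4 - ‖z₀‖) ^ d * m ^ p = (2 * δ) ^ d * m ^ p := by rw [hδ]; ring_nf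
    _ = 2 ^ d * (δ ^ d * V) * m ^ p / V := by rw [mul_pow]; field_simp
    _ ≤ 2 ^ d * (2 * c * m ^ (-p) * J) * m ^ p / V := by gcongr
    _ = 2 ^ d * (2 * c / V) * J * (m ^ (-p) * m ^ p) := by ring
    _ = _ := by rw [hmp, mul_one]

/-- The Schwarz lemma from the ball of radius `1/2` to a ball of radius `2A` around `F 0`; the slope
is `2A/(1/2)`. -/
lemma norm_sub_le_of_bounded {F : CSpace n → ℂ} (hF : DifferentiableOn ℂ F (ball 0 1)) {A : ℝ}
    (hA : ∀ u : CSpace n, ‖u‖ ≤ 1 / 2 → ‖F u‖ ≤ A) {z : CSpace n} (hz : ‖z‖ < 1 / 2) :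
    ‖F z - F 0‖ ≤ 4 * A * ‖z‖ := by
  have h := Complex.dist_le_div_mul_dist_of_mapsTo_ball (f := F) (c := 0) (R₁ := 1 / 2)
    (R₂ := 2 * A) (hF.mono (ball_subset_ball (by norm_num))) (fun u hu => by
      rw [mem_ball_zero_iff] at hu
      rw [mem_closedBall, dist_eq_norm]
      have := norm_sub_le (F u) (F 0)
      have := hA u hu.le
      have := hA 0 (by simp)
      linarith) (mem_ball_zero_iff.2 hz)
  rw [dist_eq_norm, dist_zero_right] at h
  linarith

end SubMean

/-! ### A Hardy-type inequality on an interval. -/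

section Hardy

open scoped ENNReal

lemma ENNReal.add_add_rpow_le {p : ℝ} (hp : 0 ≤ p) (a b c : ℝ≥0∞) :
    (a + b + c) ^ p ≤ 3 ^ p * (a ^ p + b ^ p + c ^ p) := by
  have h1 : a + b + c ≤ 3 * max (max a b) c := by
    calc a + b + c ≤ max (max a b) c + max (max a b) c + max (max a b) c := by
          gcongr <;> simp
      _ = _ := by ring
  calc (a + b + c) ^ p ≤ (3 * max (max a b) c) ^ p := by gcongr
    _ = 3 ^ p * (max (max a b) c) ^ p := ENNReal.mul_rpow_of_nonneg _ _ hp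
    _ ≤ _ := by
      gcongr
      rcases max_choice (max a b) c with h | h <;> rw [h]
      · rcases max_choice a b with h | h <;> rw [h]
        · exact le_self_add.trans le_self_add
        · exact le_add_self.trans le_self_add
      · exact le_add_self

/-- In the substitution `s = K t` the differential contributes `K⁻¹` and the weight `K^(-α)`. -/
lemma lintegral_comp_mul_left_rpow {K α : ℝ} (hK : 0 < K) (ε δ : ℝ) (hε : 0 ≤ ε)
    (H : ℝ → ℝ≥0∞) :
    ∫⁻ t in Set.Ioo (ε / K) (δ / K), H (K * t) * ENNReal.ofReal (t ^ α) =
      ENNReal.ofReal (K ^ (-(1 + α))) * ∫⁻ t in Set.Ioo ε δ, H t * ENNReal.ofReal (t ^ α) := by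
  have hmul : MeasurableEmbedding (fun t : ℝ => K * t) :=
    (Homeomorph.mulLeft₀ K hK.ne').measurableEmbedding
  have h1 : ∫⁻ t in Set.Ioo ε δ, H t * ENNReal.ofReal ((t / K) ^ α) =
      ENNReal.ofReal K * ∫⁻ t in Set.Ioo (ε / K) (δ / K), H (K * t) * ENNReal.ofReal (t ^ α) := by
    have h2 := Real.smul_map_volume_mul_left hK.ne'
    rw [abs_of_pos hK] at h2
    conv_lhs =>
      rw [← h2, Measure.restrict_smul, lintegral_smul_measure, hmul.restrict_map,
        hmul.lintegral_map, smul_eq_mul]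
    have hs : (fun t : ℝ => K * t) ⁻¹' Set.Ioo ε δ = Set.Ioo (ε / K) (δ / K) := by
      ext t
      simp [div_lt_iff₀ hK, lt_div_iff₀ hK, mul_comm]
    rw [hs]
    simp [hK.ne']
  have h3 : ∫⁻ t in Set.Ioo ε δ, H t * ENNReal.ofReal ((t / K) ^ α) =
      ENNReal.ofReal (K ^ (-α)) * ∫⁻ t in Set.Ioo ε δ, H t * ENNReal.ofReal (t ^ α) := by
    rw [← lintegral_const_mul' _ _ ENNReal.ofReal_ne_top]
    refine setLIntegral_congr_fun measurableSet_Ioo fun t ht => ?_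
    have ht0 : 0 ≤ t := hε.trans ht.1.le
    rw [Real.div_rpow ht0 hK.le, div_eq_mul_inv, ← Real.rpow_neg hK.le,
      ENNReal.ofReal_mul (by positivity)]
    ring
  rw [h3] at h1
  have h4 : ENNReal.ofReal (K ^ (-(1 + α))) = ENNReal.ofReal K⁻¹ * ENNReal.ofReal (K ^ (-α)) := by
    rw [← ENNReal.ofReal_mul (by positivity), ← Real.rpow_neg_one, ← Real.rpow_add hK]
    ring_nf
  rw [h4, mul_assoc, h1, ← mul_assoc, ← ENNReal.ofReal_mul (by positivity),
    inv_mul_cancel₀ hK.ne', ENNReal.ofReal_one, one_mul]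

/-- A Hardy-type inequality: control of the differences `h t - h (K t)` controls `h`. -/
lemma lintegral_rpow_le_of_le_comp_mul {p α K : ℝ} (hp : 0 < p) (hα : -1 < α) (hK : 1 < K)
    (hKα : (3 : ℝ) ^ p * K ^ (-(1 + α)) ≤ 1 / 2) {h G : ℝ → ℝ≥0∞} (hh : Measurable h)
    (hG : Measurable G) {M : ℝ≥0∞}
    (hle : ∀ t, 0 < t → t < 1 / 2 / K → h t ≤ h (K * t) + G t + G (K * t))
    (hM : ∀ t ∈ Set.Icc (1 / 2 / K) (1 / 2), h t ≤ M)
    (hloc : ∀ ε > 0, ∃ B < ∞, ∀ t ∈ Set.Ioo ε (1 / 2), h t ≤ B) :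
    ∫⁻ t in Set.Ioo 0 (1 / 2), h t ^ p * ENNReal.ofReal (t ^ α) ≤
      2 * (M ^ p * (∫⁻ t in Set.Icc (1 / 2 / K) (1 / 2), ENNReal.ofReal (t ^ α)) +
        2 * 3 ^ p * ∫⁻ t in Set.Ioo 0 (1 / 2), G t ^ p * ENNReal.ofReal (t ^ α)) := by
  have hK0 : 0 < K := one_pos.trans hK
  set w : ℝ → ℝ≥0∞ := fun t => ENNReal.ofReal (t ^ α) with hw
  have hwm : Measurable w := by fun_prop
  set A := ∫⁻ t in Set.Ioo 0 (1 / 2), G t ^ p * w t with hA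
  set W := ∫⁻ t in Set.Icc (1 / 2 / K) (1 / 2), w t with hW
  set κ := ENNReal.ofReal (K ^ (-(1 + α))) with hκ
  have hκ1 : κ ≤ 1 := by
    rw [hκ, ← ENNReal.ofReal_one]
    exact ENNReal.ofReal_le_ofReal (Real.rpow_le_one_of_one_le_of_nonpos hK.le (by linarith))
  have hκ2 : 3 ^ p * κ ≤ 2⁻¹ := by
    have h3 : (3 : ℝ≥0∞) ^ p = ENNReal.ofReal (3 ^ p) := by
      rw [← ENNReal.ofReal_rpow_of_pos (by norm_num)]; norm_num
    rw [h3, hκ, ← ENNReal.ofReal_mul (by positivity)]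
    refine (ENNReal.ofReal_le_ofReal hKα).trans_eq ?_
    rw [one_div, ENNReal.ofReal_inv_of_pos two_pos]; norm_num
  have hdiv : (1 : ℝ) / 2 / K ≤ 1 / 2 := div_le_self (by norm_num) hK.le
  -- Absorption requires a finite integral, hence the truncation at `ε`. The bound does not depend
  -- on `ε`, and scaling up by `K > 1` never leaves the truncated interval.
  have main : ∀ ε > 0, ∫⁻ t in Set.Ioo ε (1 / 2), h t ^ p * w t ≤
      2 * (M ^ p * W + 2 * 3 ^ p * A) := by
    intro ε hε
    set I := ∫⁻ t in Set.Ioo ε (1 / 2), h t ^ p * w t with hI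
    have hIfin : I ≠ ∞ := by
      obtain ⟨B, hB, hBh⟩ := hloc ε hε
      have hwfin : ∫⁻ t in Set.Icc ε (1 / 2), w t < ∞ := by
        have : IntegrableOn (fun t : ℝ => t ^ α) (Set.Icc ε (1 / 2)) := by
          refine ContinuousOn.integrableOn_compact isCompact_Icc ?_
          exact continuousOn_id.rpow_const fun t ht => Or.inl (hε.trans_le ht.1).ne'
        exact this.lintegral_lt_top
      have : I ≤ ∫⁻ t in Set.Icc ε (1 / 2), B ^ p * w t := by
        refine (setLIntegral_mono' measurableSet_Ioo fun t ht => ?_).trans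
          (lintegral_mono_set Set.Ioo_subset_Icc_self)
        gcongr
        exact hBh t ht
      refine (this.trans_lt ?_).ne
      rw [lintegral_const_mul _ hwm]
      exact ENNReal.mul_lt_top (ENNReal.rpow_lt_top_of_nonneg hp.le hB.ne) hwfin
    have h1 : ∫⁻ t in Set.Icc (1 / 2 / K) (1 / 2), h t ^ p * w t ≤ M ^ p * W := by
      rw [hW, ← lintegral_const_mul _ hwm]
      refine setLIntegral_mono' measurableSet_Icc fun t ht => ?_
      gcongr
      exact hM t ht
    have h2 : ∫⁻ t in Set.Ioo ε (1 / 2 / K), h t ^ p * w t ≤ 3 ^ p * (κ * I + A + A) := by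
      calc ∫⁻ t in Set.Ioo ε (1 / 2 / K), h t ^ p * w t
          ≤ ∫⁻ t in Set.Ioo ε (1 / 2 / K),
              3 ^ p * (h (K * t) ^ p * w t + G t ^ p * w t + G (K * t) ^ p * w t) := by
            refine setLIntegral_mono' measurableSet_Ioo fun t ht => ?_
            calc h t ^ p * w t ≤ (h (K * t) + G t + G (K * t)) ^ p * w t := by
                  gcongr
                  exact hle t (hε.trans ht.1) ht.2
              _ ≤ 3 ^ p * (h (K * t) ^ p + G t ^ p + G (K * t) ^ p) * w t := by
                  gcongr
                  exact ENNReal.add_add_rpow_le hp.le _ _ _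
              _ = _ := by ring
        _ = 3 ^ p * ((∫⁻ t in Set.Ioo ε (1 / 2 / K), h (K * t) ^ p * w t) +
              (∫⁻ t in Set.Ioo ε (1 / 2 / K), G t ^ p * w t) +
              ∫⁻ t in Set.Ioo ε (1 / 2 / K), G (K * t) ^ p * w t) := by
            rw [lintegral_const_mul _ (by fun_prop), lintegral_add_left (by fun_prop),
              lintegral_add_left (by fun_prop)]
        _ ≤ _ := by
            gcongr
            · calc _ ≤ ∫⁻ t in Set.Ioo (ε / K) (1 / 2 / K), h (K * t) ^ p * w t :=
                    lintegral_mono_set (Set.Ioo_subset_Ioo_left (div_le_self hε.le hK.le))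
                _ = _ := lintegral_comp_mul_left_rpow hK0 ε (1 / 2) hε.le fun t => h t ^ p
            · exact lintegral_mono_set (Set.Ioo_subset_Ioo hε.le hdiv)
            · calc _ ≤ ∫⁻ t in Set.Ioo (0 / K) (1 / 2 / K), G (K * t) ^ p * w t :=
                    lintegral_mono_set (Set.Ioo_subset_Ioo_left (by simpa using hε.le))
                _ = κ * A := lintegral_comp_mul_left_rpow hK0 0 (1 / 2) le_rfl fun t => G t ^ p
                _ ≤ A := mul_le_of_le_one_left' hκ1
    have h3 : I ≤ I / 2 + (M ^ p * W + 2 * 3 ^ p * A) := by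
      calc I ≤ ∫⁻ t in Set.Ioo ε (1 / 2 / K) ∪ Set.Icc (1 / 2 / K) (1 / 2), h t ^ p * w t := by
            refine lintegral_mono_set fun t ht => ?_
            rcases lt_or_ge t (1 / 2 / K) with h | h
            · exact Or.inl ⟨ht.1, h⟩
            · exact Or.inr ⟨h, ht.2.le⟩
        _ ≤ 3 ^ p * (κ * I + A + A) + M ^ p * W :=
            (lintegral_union_le _ _ _).trans (add_le_add h2 h1)
        _ = 3 ^ p * κ * I + (M ^ p * W + 2 * 3 ^ p * A) := by ring
        _ ≤ 2⁻¹ * I + (M ^ p * W + 2 * 3 ^ p * A) := by gcongr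
        _ = _ := by rw [ENNReal.div_eq_inv_mul]
    have h4 : I / 2 ≤ M ^ p * W + 2 * 3 ^ p * A := by
      refine (ENNReal.add_le_add_iff_left (ENNReal.div_ne_top hIfin two_ne_zero)).1 ?_
      rwa [ENNReal.add_halves]
    rw [ENNReal.div_le_iff two_ne_zero ENNReal.ofNat_ne_top] at h4
    rwa [mul_comm]
  have hU : Set.Ioo (0 : ℝ) (1 / 2) = ⋃ k : ℕ, Set.Ioo (1 / ((k : ℝ) + 1)) (1 / 2) := by
    ext t
    simp only [Set.mem_iUnion, Set.mem_Ioo]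
    constructor
    · rintro ⟨h0, h1⟩
      obtain ⟨k, hk⟩ := exists_nat_one_div_lt h0
      exact ⟨k, hk, h1⟩
    · rintro ⟨k, h0, h1⟩
      exact ⟨lt_trans (by positivity) h0, h1⟩
  have hmono : Monotone fun k : ℕ => Set.Ioo (1 / ((k : ℝ) + 1)) (1 / 2) := fun i j hij =>
    Set.Ioo_subset_Ioo_left (by gcongr)
  rw [hU, setLIntegral_iUnion_of_directed _ hmono.directed_le]
  exact iSup_le fun k => main _ (by positivity)

end Hardy

/-! ### The Hardy inequality on the ball, ray by ray. -/

section Polar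

open scoped ENNReal

lemma lintegral_ball_eq_lintegral_sphere {E : Type*} [NormedAddCommGroup E] [NormedSpace ℝ E]
    [Nontrivial E] [FiniteDimensional ℝ E] [MeasurableSpace E] [BorelSpace E] (μ : Measure E)
    [μ.IsAddHaarMeasure] {H : E → ℝ≥0∞} (hH : Measurable H) :
    ∫⁻ z in ball 0 1, H z ∂μ = ∫⁻ σ : sphere (0 : E) 1, (∫⁻ r in Set.Ioo (0 : ℝ) 1,
      ENNReal.ofReal (r ^ (Module.finrank ℝ E - 1)) * H (r • (σ : E))) ∂μ.toSphere := by
  have hH' : Measurable ((ball (0 : E) 1).indicator H) := hH.indicator measurableSet_ball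
  set H' := (ball (0 : E) 1).indicator H with hH'def
  have h1 := (μ.measurePreserving_homeomorphUnitSphereProd).lintegral_comp_emb
    (homeomorphUnitSphereProd E).measurableEmbedding
    (fun x => H' ((x.2 : ℝ) • (x.1 : E)))
  have h2 : ∀ x : ({0}ᶜ : Set E), H' (((homeomorphUnitSphereProd E x).2 : ℝ) •
      ((homeomorphUnitSphereProd E x).1 : E)) = H' x := by
    intro x
    have hx : ‖(x : E)‖ ≠ 0 := norm_ne_zero_iff.2 x.2
    simp [smul_smul, hx]
  simp only [h2] at h1
  have h3 : ∫⁻ z, H' z ∂μ = ∫⁻ z in {(0 : E)}ᶜ, H' z ∂μ := by rw [restrict_compl_singleton]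
  rw [← lintegral_indicator measurableSet_ball, ← hH'def, h3,
    ← lintegral_subtype_comap (measurableSet_singleton _).compl, h1,
    lintegral_prod _ (by fun_prop)]
  refine lintegral_congr fun σ => ?_
  have hσ : ‖(σ : E)‖ = 1 := mem_sphere_zero_iff_norm.1 σ.2
  rw [Measure.volumeIoiPow, lintegral_withDensity_eq_lintegral_mul _ (by fun_prop) (by fun_prop)]
  simp only [Pi.mul_apply]
  rw [lintegral_subtype_comap measurableSet_Ioi
    (fun r : ℝ => ENNReal.ofReal (r ^ (Module.finrank ℝ E - 1)) * H' (r • (σ : E))),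
    ← Set.Ioi_inter_Iio, Set.inter_comm, ← setLIntegral_indicator measurableSet_Iio]
  refine setLIntegral_congr_fun measurableSet_Ioi fun r hr => ?_
  have hr' : (0 : ℝ) < r := hr
  by_cases h : r < 1
  · have : r • (σ : E) ∈ ball (0 : E) 1 := by
      rw [mem_ball_zero_iff, norm_smul, hσ, mul_one, Real.norm_of_nonneg hr'.le]; exact h
    simp [hH'def, this, h]
  · have : r • (σ : E) ∉ ball (0 : E) 1 := by
      rw [mem_ball_zero_iff, norm_smul, hσ, mul_one, Real.norm_of_nonneg hr'.le]; exact h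
    simp [hH'def, this, h]

lemma setLIntegral_one_sub (Q : ℝ → ℝ≥0∞) :
    ∫⁻ t in Set.Ioo (0 : ℝ) (1 / 2), Q (1 - t) = ∫⁻ r in Set.Ioo (1 / 2 : ℝ) 1, Q r := by
  have h := (Measure.measurePreserving_sub_left volume (1 : ℝ)).setLIntegral_comp_preimage_emb
    (MeasurableEquiv.subLeft (1 : ℝ)).measurableEmbedding Q (Set.Ioo (1 / 2) 1)
  rw [← h]
  congr 2
  ext t
  simp only [Set.mem_preimage, Set.mem_Ioo]
  constructor <;> rintro ⟨h1, h2⟩ <;> constructor <;> linarith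

variable {n : ℕ}

lemma ContinuousOn.measurable_indicator_enorm {E : Type*} [NormedAddCommGroup E]
    {f : CSpace n → E} (hf : ContinuousOn f (ball 0 1)) :
    Measurable ((ball (0 : CSpace n) 1).indicator fun z => ‖f z‖ₑ) := by
  classical
  rw [← Set.piecewise_eq_indicator]
  exact (continuous_enorm.comp_continuousOn hf).measurable_piecewise continuousOn_const
    measurableSet_ball

/-- If the radial differences of `f` are controlled by a function `G` in a weighted `L^p` space,
then `f` is in the same space. -/
lemma lintegral_ball_rpow_lt_top {E : Type*} [NormedAddCommGroup E] {p α K : ℝ} (hp : 0 < p)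
    (hα : -1 < α) (hK : 1 < K) (hKα : (3 : ℝ) ^ p * K ^ (-(1 + α)) ≤ 1 / 2) {f : CSpace n → E}
    {G : CSpace n → ℝ} (hf : ContinuousOn f (ball 0 1)) (hG : ContinuousOn G (ball 0 1))
    (hle : ∀ σ : CSpace n, ‖σ‖ = 1 → ∀ t : ℝ, 0 < t → t < 1 / 2 / K →
      ‖f ((1 - t) • σ)‖ ≤ ‖f ((1 - K * t) • σ)‖ + G ((1 - t) • σ) + G ((1 - K * t) • σ))
    (hGp : ∫⁻ z in ball 0 1, ‖G z‖ₑ ^ p * ENNReal.ofReal ((1 - ‖z‖) ^ α) < ∞) :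
    ∫⁻ z in ball 0 1, ‖f z‖ₑ ^ p * ENNReal.ofReal ((1 - ‖z‖) ^ α) < ∞ := by
  -- For `n = 0` the ball is a single point and polar coordinates do not apply.
  rcases Nat.eq_zero_or_pos n with rfl | hn
  · have : ∀ z : CSpace 0, ‖f z‖ₑ ^ p * ENNReal.ofReal ((1 - ‖z‖) ^ α) = ‖f 0‖ₑ ^ p := fun z => by
      rw [Subsingleton.elim z 0]; simp
    simp only [this, lintegral_const, Measure.restrict_apply_univ]
    exact ENNReal.mul_lt_top (ENNReal.rpow_lt_top_of_nonneg hp.le enorm_ne_top)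
      measure_ball_lt_top
  have : Nonempty (Fin n) := ⟨⟨0, hn⟩⟩
  have hK0 : 0 < K := one_pos.trans hK
  set d := Module.finrank ℝ (CSpace n) with hd
  -- Continuity is only known on the ball; extension by zero gives globally measurable functions.
  set f₀ : CSpace n → ℝ≥0∞ := (ball (0 : CSpace n) 1).indicator fun z => ‖f z‖ₑ with hf₀
  set G₀ : CSpace n → ℝ≥0∞ := (ball (0 : CSpace n) 1).indicator fun z => ‖G z‖ₑ with hG₀
  have hf₀m : Measurable f₀ := hf.measurable_indicator_enorm
  have hG₀m : Measurable G₀ := hG.measurable_indicator_enorm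
  set w : CSpace n → ℝ≥0∞ := fun z => ENNReal.ofReal ((1 - ‖z‖) ^ α) with hw
  have hwm : Measurable w := by fun_prop
  have hfeq : ∫⁻ z in ball 0 1, ‖f z‖ₑ ^ p * w z = ∫⁻ z in ball 0 1, f₀ z ^ p * w z :=
    setLIntegral_congr_fun measurableSet_ball fun z hz => by simp only [hf₀, Set.indicator_of_mem hz]
  have hGeq : ∫⁻ z in ball 0 1, ‖G z‖ₑ ^ p * w z = ∫⁻ z in ball 0 1, G₀ z ^ p * w z :=
    setLIntegral_congr_fun measurableSet_ball fun z hz => by simp only [hG₀, Set.indicator_of_mem hz]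
  have hcomp : ∀ ε > 0, ∃ B : ℝ≥0∞, B < ∞ ∧ ∀ z ∈ closedBall (0 : CSpace n) (1 - ε), f₀ z ≤ B := by
    intro ε hε
    have hsub : closedBall (0 : CSpace n) (1 - ε) ⊆ ball 0 1 := closedBall_subset_ball (by linarith)
    obtain ⟨B, hB⟩ := (isCompact_closedBall (0 : CSpace n) (1 - ε)).exists_bound_of_continuousOn
      (hf.mono hsub)
    refine ⟨ENNReal.ofReal B, ENNReal.ofReal_lt_top, fun z hz => ?_⟩
    rw [hf₀, Set.indicator_of_mem (hsub hz), ← ofReal_norm]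
    exact ENNReal.ofReal_le_ofReal (hB z hz)
  -- This radius covers both the inner half of each ray and the starting interval `[1/(2K), 1/2]` of
  -- the Hardy inequality.
  obtain ⟨M, hM, hfM⟩ := hcomp (1 / 2 / K) (by positivity)
  have hdiv : (1 : ℝ) / 2 / K ≤ 1 / 2 := div_le_self (by norm_num) hK.le
  have hW : ∀ a > 0, ∀ b : ℝ, ∫⁻ t in Set.Icc a b, ENNReal.ofReal (t ^ α) < ∞ := by
    intro a ha b
    have : IntegrableOn (fun t : ℝ => t ^ α) (Set.Icc a b) :=
      (continuousOn_id.rpow_const fun t ht =>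
        Or.inl (ha.trans_le ht.1).ne').integrableOn_compact isCompact_Icc
    exact this.lintegral_lt_top
  set W := ∫⁻ t in Set.Icc (1 / 2 / K) (1 / 2), ENNReal.ofReal (t ^ α) with hWdef
  set W' := ∫⁻ r in Set.Ioc (0 : ℝ) (1 / 2), ENNReal.ofReal ((1 - r) ^ α) with hW'def
  have hW' : W' < ∞ := by
    have : IntegrableOn (fun r : ℝ => (1 - r) ^ α) (Set.Icc 0 (1 / 2)) := by
      refine ContinuousOn.integrableOn_compact isCompact_Icc ?_
      refine (by fun_prop : Continuous fun r : ℝ => 1 - r).continuousOn.rpow_const fun r hr => ?_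
      left
      have := hr.2
      linarith
    exact (lintegral_mono_set Set.Ioc_subset_Icc_self).trans_lt this.lintegral_lt_top
  -- The factor `2 * (2 * 3 ^ p)` comes from the Hardy inequality; `2 ^ (d - 1)` restores the radial
  -- density, since `1 ≤ (2r)^(d-1)` for `r ≥ 1/2`.
  set c : ℝ≥0∞ := 2 * (2 * 3 ^ p) * 2 ^ (d - 1) with hc
  have hcfin : c ≠ ∞ := by
    have : (3 : ℝ≥0∞) ^ p ≠ ∞ := ENNReal.rpow_ne_top_of_nonneg hp.le (by norm_num)
    rw [hc]
    finiteness
  have hray : ∀ σ : sphere (0 : CSpace n) 1,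
      ∫⁻ r in Set.Ioo (0 : ℝ) 1, ENNReal.ofReal (r ^ (d - 1)) *
        (f₀ (r • (σ : CSpace n)) ^ p * w (r • (σ : CSpace n))) ≤
      (M ^ p * W' + 2 * (M ^ p * W)) + c * ∫⁻ r in Set.Ioo (0 : ℝ) 1, ENNReal.ofReal (r ^ (d - 1)) *
        (G₀ (r • (σ : CSpace n)) ^ p * w (r • (σ : CSpace n))) := by
    intro σ
    have hσ : ‖(σ : CSpace n)‖ = 1 := mem_sphere_zero_iff_norm.1 σ.2
    have hnorm : ∀ r : ℝ, 0 ≤ r → ‖r • (σ : CSpace n)‖ = r := fun r hr => by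
      rw [norm_smul, hσ, mul_one, Real.norm_of_nonneg hr]
    have hwr : ∀ r : ℝ, 0 ≤ r → w (r • (σ : CSpace n)) = ENNReal.ofReal ((1 - r) ^ α) :=
      fun r hr => by rw [hw]; simp only [hnorm r hr]
    have hinner : ∫⁻ r in Set.Ioc (0 : ℝ) (1 / 2), ENNReal.ofReal (r ^ (d - 1)) *
        (f₀ (r • (σ : CSpace n)) ^ p * w (r • (σ : CSpace n))) ≤ M ^ p * W' := by
      rw [hW'def, ← lintegral_const_mul _ (by fun_prop)]
      refine setLIntegral_mono' measurableSet_Ioc fun r hr => ?_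
      have h1 : ENNReal.ofReal (r ^ (d - 1)) ≤ 1 := by
        rw [← ENNReal.ofReal_one]
        exact ENNReal.ofReal_le_ofReal (pow_le_one₀ hr.1.le (by linarith [hr.2]))
      rw [hwr r hr.1.le]
      refine (mul_le_of_le_one_left' h1).trans ?_
      gcongr
      refine hfM _ ?_
      rw [mem_closedBall_zero_iff, hnorm r hr.1.le]
      linarith [hr.2]
    have houter : ∫⁻ r in Set.Ioo (1 / 2 : ℝ) 1, ENNReal.ofReal (r ^ (d - 1)) *
        (f₀ (r • (σ : CSpace n)) ^ p * w (r • (σ : CSpace n))) ≤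
        2 * (M ^ p * W + 2 * 3 ^ p * ∫⁻ t in Set.Ioo 0 (1 / 2),
          G₀ ((1 - t) • (σ : CSpace n)) ^ p * ENNReal.ofReal (t ^ α)) := by
      refine le_trans (b := ∫⁻ t in Set.Ioo 0 (1 / 2),
          f₀ ((1 - t) • (σ : CSpace n)) ^ p * ENNReal.ofReal (t ^ α)) ?_ ?_
      · rw [← setLIntegral_one_sub]
        refine setLIntegral_mono' measurableSet_Ioo fun t ht => ?_
        have h1 : ENNReal.ofReal ((1 - t) ^ (d - 1)) ≤ 1 := by
          rw [← ENNReal.ofReal_one]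
          exact ENNReal.ofReal_le_ofReal
            (pow_le_one₀ (by linarith [ht.2]) (by linarith [ht.1]))
        rw [hwr _ (by linarith [ht.2]), sub_sub_cancel]
        exact mul_le_of_le_one_left' h1
      · refine lintegral_rpow_le_of_le_comp_mul hp hα hK hKα
          (h := fun t => f₀ ((1 - t) • (σ : CSpace n)))
          (G := fun t => G₀ ((1 - t) • (σ : CSpace n))) (by fun_prop) (by fun_prop) ?_ ?_ ?_
        · intro t ht0 ht1
          have hKt : K * t < 1 / 2 := by rwa [lt_div_iff₀ hK0, mul_comm] at ht1
          have hKt0 : 0 < K * t := by positivity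
          have htt : t ≤ K * t := le_mul_of_one_le_left ht0.le hK.le
          have m1 : (1 - t) • (σ : CSpace n) ∈ ball (0 : CSpace n) 1 := by
            rw [mem_ball_zero_iff, hnorm _ (by linarith)]; linarith
          have m2 : (1 - K * t) • (σ : CSpace n) ∈ ball (0 : CSpace n) 1 := by
            rw [mem_ball_zero_iff, hnorm _ (by linarith)]; linarith
          simp only [hf₀, hG₀, Set.indicator_of_mem m1, Set.indicator_of_mem m2]
          simp only [← ofReal_norm]
          rw [← ENNReal.ofReal_add (by positivity) (by positivity),
            ← ENNReal.ofReal_add (by positivity) (by positivity)]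
          refine ENNReal.ofReal_le_ofReal ((hle σ hσ t ht0 ht1).trans ?_)
          gcongr <;> exact Real.le_norm_self _
        · intro t ht
          refine hfM _ ?_
          rw [mem_closedBall_zero_iff, hnorm _ (by linarith [ht.2])]
          linarith [ht.1]
        · intro ε hε
          obtain ⟨B, hB, hfB⟩ := hcomp ε hε
          refine ⟨B, hB, fun t ht => hfB _ ?_⟩
          rw [mem_closedBall_zero_iff, hnorm _ (by linarith [ht.2])]
          linarith [ht.1]
    have hGray : ∫⁻ t in Set.Ioo 0 (1 / 2),
          G₀ ((1 - t) • (σ : CSpace n)) ^ p * ENNReal.ofReal (t ^ α) ≤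
        2 ^ (d - 1) * ∫⁻ r in Set.Ioo (0 : ℝ) 1, ENNReal.ofReal (r ^ (d - 1)) *
          (G₀ (r • (σ : CSpace n)) ^ p * w (r • (σ : CSpace n))) := by
      calc _ = ∫⁻ t in Set.Ioo (0 : ℝ) (1 / 2), (fun r : ℝ => G₀ (r • (σ : CSpace n)) ^ p *
            w (r • (σ : CSpace n))) (1 - t) := by
            refine setLIntegral_congr_fun measurableSet_Ioo fun t ht => ?_
            simp only
            rw [hwr _ (by linarith [ht.2]), sub_sub_cancel]
        _ = ∫⁻ r in Set.Ioo (1 / 2 : ℝ) 1, G₀ (r • (σ : CSpace n)) ^ p *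
            w (r • (σ : CSpace n)) :=
            setLIntegral_one_sub fun r : ℝ => G₀ (r • (σ : CSpace n)) ^ p * w (r • (σ : CSpace n))
        _ ≤ ∫⁻ r in Set.Ioo (1 / 2 : ℝ) 1, 2 ^ (d - 1) * (ENNReal.ofReal (r ^ (d - 1)) *
            (G₀ (r • (σ : CSpace n)) ^ p * w (r • (σ : CSpace n)))) := by
            refine setLIntegral_mono' measurableSet_Ioo fun r hr => ?_
            rw [← mul_assoc]
            refine le_mul_of_one_le_left' ?_
            rw [ENNReal.ofReal_pow (by linarith [hr.1]), ← mul_pow]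
            refine one_le_pow₀ ?_
            have : (2 : ℝ≥0∞) = ENNReal.ofReal 2 := by norm_num
            rw [this, ← ENNReal.ofReal_mul two_pos.le, ← ENNReal.ofReal_one]
            exact ENNReal.ofReal_le_ofReal (by linarith [hr.1])
        _ ≤ ∫⁻ r in Set.Ioo (0 : ℝ) 1, 2 ^ (d - 1) * (ENNReal.ofReal (r ^ (d - 1)) *
            (G₀ (r • (σ : CSpace n)) ^ p * w (r • (σ : CSpace n)))) :=
            lintegral_mono_set (Set.Ioo_subset_Ioo_left (by norm_num))
        _ = _ := lintegral_const_mul' _ _ (by finiteness)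
    calc _ ≤ ∫⁻ r in Set.Ioc (0 : ℝ) (1 / 2) ∪ Set.Ioo (1 / 2 : ℝ) 1,
          ENNReal.ofReal (r ^ (d - 1)) *
          (f₀ (r • (σ : CSpace n)) ^ p * w (r • (σ : CSpace n))) := by
          refine lintegral_mono_set fun r hr => ?_
          rcases le_or_gt r (1 / 2) with h | h
          · exact Or.inl ⟨hr.1, h⟩
          · exact Or.inr ⟨h, hr.2⟩
      _ ≤ M ^ p * W' + 2 * (M ^ p * W + 2 * 3 ^ p * (2 ^ (d - 1) *
          ∫⁻ r in Set.Ioo (0 : ℝ) 1, ENNReal.ofReal (r ^ (d - 1)) *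
          (G₀ (r • (σ : CSpace n)) ^ p * w (r • (σ : CSpace n))))) := by
          refine (lintegral_union_le _ _ _).trans (add_le_add hinner (houter.trans ?_))
          gcongr
      _ = _ := by rw [hc]; ring
  rw [hGeq, lintegral_ball_eq_lintegral_sphere volume (by fun_prop)] at hGp
  rw [hfeq, lintegral_ball_eq_lintegral_sphere volume (by fun_prop)]
  refine (lintegral_mono hray).trans_lt ?_
  rw [lintegral_add_left measurable_const, lintegral_const_mul' _ _ hcfin, lintegral_const]
  have hMp : M ^ p ≠ ∞ := ENNReal.rpow_ne_top_of_nonneg hp.le hM.ne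
  have hW1 : W ≠ ∞ := (hW _ (by positivity) _).ne
  have hW2 := hW'.ne
  have hGp' := hGp.ne
  finiteness

end Polar

/-! ### Membership in the weighted spaces as finiteness of an integral. -/

section WeightedVolume

open scoped ENNReal

variable {n : ℕ}

/-- The two weights differ by `(1+|z|)^α`, and `1+|z|` lies in `[1, 2)`. The weight in `1-|z|` is
the one that scales along rays. -/
lemma lintegral_ball_weight_lt_top_iff (H : CSpace n → ℝ≥0∞) (α : ℝ) :
    ∫⁻ z in ball 0 1, H z * ENNReal.ofReal ((1 - ‖z‖ ^ 2) ^ α) < ∞ ↔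
      ∫⁻ z in ball 0 1, H z * ENNReal.ofReal ((1 - ‖z‖) ^ α) < ∞ := by
  have hrpow : ∀ (β : ℝ) (z : CSpace n), (1 + ‖z‖) ^ β ≤ 2 ^ |β| ∨ 1 ≤ ‖z‖ := by
    intro β z
    rcases lt_or_ge ‖z‖ 1 with h | h
    · left
      calc (1 + ‖z‖) ^ β ≤ (1 + ‖z‖) ^ |β| :=
            Real.rpow_le_rpow_of_exponent_le (by linarith [norm_nonneg z]) (le_abs_self β)
        _ ≤ 2 ^ |β| := Real.rpow_le_rpow (by positivity) (by linarith) (abs_nonneg β)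
    · exact Or.inr h
  have hfac : ∀ z ∈ ball (0 : CSpace n) 1, (1 - ‖z‖ ^ 2) ^ α = (1 + ‖z‖) ^ α * (1 - ‖z‖) ^ α := by
    intro z hz
    rw [mem_ball_zero_iff] at hz
    rw [← Real.mul_rpow (by positivity) (by linarith)]
    ring_nf
  have key : ∀ W₁ W₂ : CSpace n → ℝ, (∀ z ∈ ball (0 : CSpace n) 1, W₁ z ≤ 2 ^ |α| * W₂ z) →
      ∫⁻ z in ball 0 1, H z * ENNReal.ofReal (W₂ z) < ∞ →
      ∫⁻ z in ball 0 1, H z * ENNReal.ofReal (W₁ z) < ∞ := by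
    intro W₁ W₂ hW h
    calc _ ≤ ∫⁻ z in ball 0 1, ENNReal.ofReal (2 ^ |α|) * (H z * ENNReal.ofReal (W₂ z)) := by
          refine setLIntegral_mono' measurableSet_ball fun z hz => ?_
          rw [mul_left_comm, ← ENNReal.ofReal_mul (by positivity)]
          gcongr
          exact hW z hz
      _ = ENNReal.ofReal (2 ^ |α|) * ∫⁻ z in ball 0 1, H z * ENNReal.ofReal (W₂ z) :=
          lintegral_const_mul' _ _ ENNReal.ofReal_ne_top
      _ < ∞ := ENNReal.mul_lt_top ENNReal.ofReal_lt_top h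
  constructor
  · refine key _ _ fun z hz => ?_
    rw [hfac z hz]
    rw [mem_ball_zero_iff] at hz
    have h1 : (1 + ‖z‖) ^ (-α) ≤ 2 ^ |α| := by
      have := (hrpow (-α) z).resolve_right (not_le.2 hz)
      rwa [abs_neg] at this
    have h2 : (1 + ‖z‖) ^ (-α) * (1 + ‖z‖) ^ α = 1 := by
      rw [← Real.rpow_add (by positivity)]; simp
    have h3 : 0 ≤ (1 - ‖z‖) ^ α := Real.rpow_nonneg (by linarith) _
    calc (1 - ‖z‖) ^ α = (1 + ‖z‖) ^ (-α) * ((1 + ‖z‖) ^ α * (1 - ‖z‖) ^ α) := by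
          rw [← mul_assoc, h2, one_mul]
      _ ≤ _ := by gcongr
  · refine key _ _ fun z hz => ?_
    rw [hfac z hz]
    rw [mem_ball_zero_iff] at hz
    have h3 : 0 ≤ (1 - ‖z‖) ^ α := Real.rpow_nonneg (by linarith) _
    gcongr
    exact (hrpow α z).resolve_right (not_le.2 hz)

lemma exists_hardy_factor {p α : ℝ} (hα : -1 < α) :
    ∃ K : ℝ, 1 < K ∧ (3 : ℝ) ^ p * K ^ (-(1 + α)) ≤ 1 / 2 := by
  have h : Filter.Tendsto (fun K : ℝ => (3 : ℝ) ^ p * K ^ (-(1 + α))) Filter.atTop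
      (nhds ((3 : ℝ) ^ p * 0)) :=
    (tendsto_rpow_neg_atTop (by linarith : 0 < 1 + α)).const_mul _
  rw [mul_zero] at h
  obtain ⟨K, hK1, hK2⟩ := ((h.eventually_le_const (by norm_num : (0 : ℝ) < 1 / 2)).and
    (Filter.eventually_gt_atTop 1)).exists
  exact ⟨K, hK2, hK1⟩

/-- This is the Hardy inequality for the constant function `1` with `G = 0`. -/
lemma lintegral_weight_lt_top (n : ℕ) {α : ℝ} (hα : -1 < α) :
    ∫⁻ z : CSpace n in ball 0 1, ENNReal.ofReal ((1 - ‖z‖ ^ 2) ^ α) < ∞ := by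
  obtain ⟨K, hK, hKα⟩ := exists_hardy_factor (p := 1) hα
  have := lintegral_ball_rpow_lt_top (n := n) (f := fun _ => (1 : ℝ)) (G := fun _ => 0) one_pos hα
    hK hKα continuousOn_const continuousOn_const (by simp) (by simp)
  rw [← lintegral_ball_weight_lt_top_iff] at this
  simpa using this

lemma weightedVolume_eq (n : ℕ) {α : ℝ} (hα : -1 < α) : ∃ c : ℝ≥0∞, c ≠ 0 ∧ c ≠ ∞ ∧
    weightedVolume n α = c • (volume.restrict (ball (0 : CSpace n) 1)).withDensity
      fun z => ENNReal.ofReal ((1 - ‖z‖ ^ 2) ^ α) := by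
  have hV0 : volume (ball (0 : CSpace n) 1) ≠ 0 := (measure_ball_pos _ _ one_pos).ne'
  have hVt : volume (ball (0 : CSpace n) 1) ≠ ∞ := measure_ball_lt_top.ne
  have haux : weightedVolumeAux n α = (volume (ball (0 : CSpace n) 1))⁻¹ •
      (volume.restrict (ball (0 : CSpace n) 1)).withDensity
        fun z => ENNReal.ofReal ((1 - ‖z‖ ^ 2) ^ α) := by
    rw [weightedVolumeAux, ballVolume, withDensity_smul_measure]
    rfl
  set I := ∫⁻ z : CSpace n in ball 0 1, ENNReal.ofReal ((1 - ‖z‖ ^ 2) ^ α) with hI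
  have hIt : I ≠ ∞ := (lintegral_weight_lt_top n hα).ne
  have hI0 : I ≠ 0 := by
    rw [hI, ← pos_iff_ne_zero, lintegral_pos_iff_support (by fun_prop), pos_iff_ne_zero]
    have hsupp : ball (0 : CSpace n) 1 ⊆
        Function.support fun z : CSpace n => ENNReal.ofReal ((1 - ‖z‖ ^ 2) ^ α) := by
      intro z hz
      rw [mem_ball_zero_iff] at hz
      have : 0 < 1 - ‖z‖ ^ 2 := by nlinarith [norm_nonneg z]
      simpa using Real.rpow_pos_of_pos this α
    intro h0
    have := measure_mono_null hsupp h0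
    rw [Measure.restrict_apply_self] at this
    exact hV0 this
  have huniv : weightedVolumeAux n α Set.univ = (volume (ball (0 : CSpace n) 1))⁻¹ * I := by
    rw [haux, Measure.smul_apply, withDensity_apply _ MeasurableSet.univ, Measure.restrict_univ,
      smul_eq_mul]
  refine ⟨(weightedVolumeAux n α Set.univ)⁻¹ * (volume (ball (0 : CSpace n) 1))⁻¹, ?_, ?_, ?_⟩
  · rw [huniv]
    refine mul_ne_zero (ENNReal.inv_ne_zero.2 ?_) (ENNReal.inv_ne_zero.2 hVt)
    exact ENNReal.mul_ne_top (ENNReal.inv_ne_top.2 hV0) hIt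
  · rw [huniv]
    refine ENNReal.mul_ne_top (ENNReal.inv_ne_top.2 ?_) (ENNReal.inv_ne_top.2 hV0)
    exact mul_ne_zero (ENNReal.inv_ne_zero.2 hVt) hI0
  · rw [weightedVolume, haux, smul_smul, ← haux]

lemma memLp_weightedVolume_iff {E : Type*} [NormedAddCommGroup E] {p α : ℝ} (hp : 0 < p)
    (hα : -1 < α) {f : CSpace n → E} (hf : ContinuousOn f (ball 0 1)) :
    MemLp f (ENNReal.ofReal p) (weightedVolume n α) ↔
      ∫⁻ z in ball 0 1, ‖f z‖ₑ ^ p * ENNReal.ofReal ((1 - ‖z‖ ^ 2) ^ α) < ∞ := by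
  obtain ⟨c, hc0, hct, hc⟩ := weightedVolume_eq n hα
  have hm : AEStronglyMeasurable f (weightedVolume n α) := by
    rw [hc]
    refine (hf.aestronglyMeasurable (μ := volume) measurableSet_ball).mono_ac ?_
    exact (Measure.smul_absolutelyContinuous).trans (withDensity_absolutelyContinuous _ _)
  have hwm : Measurable fun z : CSpace n => ENNReal.ofReal ((1 - ‖z‖ ^ 2) ^ α) := by fun_prop
  rw [MemLp, and_iff_right hm, eLpNorm_lt_top_iff_lintegral_rpow_enorm_lt_top
    (by simpa using hp) ENNReal.ofReal_ne_top, ENNReal.toReal_ofReal hp.le, hc,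
    lintegral_smul_measure, lintegral_withDensity_eq_lintegral_mul_non_measurable _ hwm
      (ae_of_all _ fun _ => ENNReal.ofReal_lt_top), smul_eq_mul,
    ENNReal.mul_lt_top_iff]
  simp only [hc0, false_or, Pi.mul_apply, lt_top_iff_ne_top, ne_eq, hct, not_false_eq_true,
    true_and, mul_comm (ENNReal.ofReal _)]
  constructor
  · rintro (h | h)
    · exact h
    · rw [h]; simp
  · exact Or.inl

end WeightedVolume

/-! ### The Jacobian average and its integrability. -/

section Average

open scoped ENNReal

variable {n : ℕ}

/-- The real Jacobian of `ballInvolution a` at `z`. -/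
noncomputable def involutionJacobian (a z : CSpace n) : ℝ :=
  ((1 - ‖a‖ ^ 2) / ‖1 - inner ℂ a z‖ ^ 2) ^ (n + 1)

lemma one_sub_sq_pos {z : CSpace n} (hz : ‖z‖ < 1) : 0 < 1 - ‖z‖ ^ 2 := by
  nlinarith [norm_nonneg z]

lemma norm_one_sub_inner_symm (a z : CSpace n) : ‖1 - inner ℂ a z‖ = ‖1 - inner ℂ z a‖ := by
  rw [← inner_conj_symm a z, ← Complex.norm_conj]
  simp

lemma involutionJacobian_nonneg {a : CSpace n} (ha : ‖a‖ < 1) (z : CSpace n) :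
    0 ≤ involutionJacobian a z := by
  have := one_sub_sq_pos ha
  unfold involutionJacobian
  positivity

lemma involutionJacobian_le {a z : CSpace n} (ha : ‖a‖ < 1) {r : ℝ} (hr : r < 1) (hz : ‖z‖ ≤ r) :
    involutionJacobian a z ≤ (1 / (1 - r) ^ 2) ^ (n + 1) := by
  have h := one_sub_sq_pos ha
  have h1 : 1 - r ≤ ‖1 - inner ℂ a z‖ := by
    rw [norm_one_sub_inner_symm]
    have := one_sub_norm_le (a := z) ha.le
    linarith
  have h2 : 0 < 1 - r := by linarith
  unfold involutionJacobian
  gcongr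
  nlinarith [norm_nonneg a]

lemma continuousOn_involutionJacobian : ContinuousOn
    (fun x : CSpace n × CSpace n => involutionJacobian x.1 x.2) (ball 0 1 ×ˢ ball 0 1) := by
  unfold involutionJacobian
  refine ContinuousOn.pow (ContinuousOn.div (by fun_prop) (by fun_prop) ?_) _
  rintro ⟨a, z⟩ ⟨ha, hz⟩
  simp only [mem_ball_zero_iff] at ha hz
  exact pow_ne_zero _ (norm_ne_zero_iff.2 (one_sub_inner_ne_zero ha hz.le))

lemma lintegral_ball_eq_lintegral_involution {a : CSpace n} (ha : ‖a‖ < 1)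
    (H : CSpace n → ℝ≥0∞) :
    ∫⁻ z in ball 0 1, H z =
      ∫⁻ z in ball 0 1, ENNReal.ofReal (involutionJacobian a z) * H (ballInvolution a z) := by
  have hb := bijOn_ballInvolution ha
  have h := lintegral_image_eq_lintegral_abs_det_fderiv_mul volume
    (s := ball (0 : CSpace n) 1) measurableSet_ball (f := ballInvolution a)
    (f' := fun z => (involutionDeriv a z).restrictScalars ℝ)
    (fun z hz => ((hasFDerivAt_ballInvolution ha
      (mem_ball_zero_iff.1 hz).le).restrictScalars ℝ).hasFDerivWithinAt) hb.injOn H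
  rw [show ballInvolution a '' ball 0 1 = ball 0 1 from hb.image_eq] at h
  rw [h]
  refine setLIntegral_congr_fun measurableSet_ball fun z hz => ?_
  simp only [abs_det_involutionDeriv ha (mem_ball_zero_iff.1 hz).le, involutionJacobian]

lemma lintegral_involutionJacobian {a : CSpace n} (ha : ‖a‖ < 1) :
    ∫⁻ z in ball 0 1, ENNReal.ofReal (involutionJacobian a z) = volume (ball (0 : CSpace n) 1) := by
  have := lintegral_ball_eq_lintegral_involution ha fun _ => 1
  simpa using this.symm

/-- The substitution `u = ballInvolution a z` in `involutionAverage` produces this product. The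
right side is comparable to `(1-|a|²)^α` as long as `|z|` stays away from `1`. -/
lemma involutionJacobian_mul {a z : CSpace n} (ha : ‖a‖ < 1) (hz : ‖z‖ < 1) (α : ℝ) :
    involutionJacobian a z * ((1 - ‖ballInvolution a z‖ ^ 2) ^ α *
      involutionJacobian (ballInvolution a z) a) =
    (1 - ‖a‖ ^ 2) ^ α * ((1 - ‖z‖ ^ 2) / ‖1 - inner ℂ a z‖ ^ 2) ^ (α + (n + 1)) := by
  have hA := one_sub_sq_pos ha
  have hb := one_sub_sq_pos hz
  have hm := norm_pos_iff.2 (one_sub_inner_ne_zero ha hz.le)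
  have h1 : ‖1 - inner ℂ (ballInvolution a z) a‖ = (1 - ‖a‖ ^ 2) / ‖1 - inner ℂ a z‖ := by
    rw [norm_one_sub_inner_symm, inner_ballInvolution ha hz.le, norm_div, norm_pow,
      Complex.norm_real, Real.norm_of_nonneg (Real.sqrt_nonneg _), Real.sq_sqrt hA.le]
  unfold involutionJacobian
  rw [h1, one_sub_norm_ballInvolution_sq ha hz.le]
  set A := 1 - ‖a‖ ^ 2
  set b := 1 - ‖z‖ ^ 2
  set m := ‖1 - inner ℂ a z‖
  have h2 : α + ((n : ℝ) + 1) = α + ((n + 1 : ℕ) : ℝ) := by push_cast; ring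
  rw [h2, Real.rpow_add (by positivity), Real.rpow_natCast, mul_div_assoc A b,
    Real.mul_rpow hA.le (by positivity)]
  have h3 : A * (b / m ^ 2) / (A / m) ^ 2 = b / A := by field_simp
  have h4 : (A / m ^ 2) ^ (n + 1) * (b / A) ^ (n + 1) = (b / m ^ 2) ^ (n + 1) := by
    rw [← mul_pow]
    congr 1
    field_simp
  rw [h3, ← h4]
  ring

/-- The weighted Berezin-type average `∫ h(u) J(u, z) dv(u)`. -/
noncomputable def involutionAverage (h : CSpace n → ℝ) (z : CSpace n) : ℝ :=
  ∫ u in ball 0 1, h u * involutionJacobian u z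

lemma aestronglyMeasurable_involutionJacobian {z : CSpace n} (hz : ‖z‖ < 1) :
    AEStronglyMeasurable (fun u => involutionJacobian u z) (volume.restrict (ball 0 1)) := by
  refine ContinuousOn.aestronglyMeasurable ?_ measurableSet_ball
  exact continuousOn_involutionJacobian.comp (f := fun u => (u, z)) (by fun_prop)
    fun u hu => ⟨hu, mem_ball_zero_iff.2 hz⟩

lemma integrableOn_mul_involutionJacobian {h : CSpace n → ℝ} (hh : IntegrableOn h (ball 0 1))
    {z : CSpace n} (hz : ‖z‖ < 1) :
    IntegrableOn (fun u => h u * involutionJacobian u z) (ball 0 1) := by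
  refine Integrable.mul_bdd (c := (1 / (1 - ‖z‖) ^ 2) ^ (n + 1)) hh
    (aestronglyMeasurable_involutionJacobian hz) ?_
  filter_upwards [ae_restrict_mem measurableSet_ball] with u hu
  rw [mem_ball_zero_iff] at hu
  rw [Real.norm_of_nonneg (involutionJacobian_nonneg hu z)]
  exact involutionJacobian_le hu hz le_rfl

/-- Dominated convergence: for `|z| ≤ r < 1` the Jacobian is bounded uniformly in `u`. -/
lemma continuousOn_involutionAverage {h : CSpace n → ℝ} (hh : IntegrableOn h (ball 0 1)) :
    ContinuousOn (involutionAverage h) (ball 0 1) := by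
  intro z₀ hz₀
  obtain ⟨r, hr0, hr1⟩ := exists_between (mem_ball_zero_iff.1 hz₀)
  refine ContinuousAt.continuousWithinAt ?_
  have hnear : ∀ᶠ z in nhds z₀, ‖z‖ < r :=
    (isOpen_lt continuous_norm continuous_const).mem_nhds hr0
  refine continuousAt_of_dominated
    (bound := fun u => ‖h u‖ * (1 / (1 - r) ^ 2) ^ (n + 1)) ?_ ?_ (hh.norm.mul_const _) ?_
  · filter_upwards [hnear] with z hz
    exact (integrableOn_mul_involutionJacobian hh (hz.trans hr1)).aestronglyMeasurable
  · filter_upwards [hnear] with z hz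
    filter_upwards [ae_restrict_mem measurableSet_ball] with u hu
    rw [mem_ball_zero_iff] at hu
    rw [norm_mul, Real.norm_of_nonneg (involutionJacobian_nonneg hu z)]
    gcongr
    exact involutionJacobian_le hu hr1 hz.le
  · filter_upwards [ae_restrict_mem measurableSet_ball] with u hu
    refine continuousAt_const.mul ?_
    have h1 : ContinuousAt (fun x : CSpace n × CSpace n => involutionJacobian x.1 x.2) (u, z₀) :=
      continuousOn_involutionJacobian.continuousAt
        ((isOpen_ball.prod isOpen_ball).mem_nhds ⟨hu, hz₀⟩)
    exact ContinuousAt.comp (f := fun z => (u, z)) (x := z₀) h1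
      (Continuous.continuousAt (by fun_prop))

lemma ofReal_involutionAverage {h : CSpace n → ℝ} (hh : IntegrableOn h (ball 0 1))
    (h0 : ∀ u, 0 ≤ h u) {z : CSpace n} (hz : ‖z‖ < 1) :
    ENNReal.ofReal (involutionAverage h z) =
      ∫⁻ u in ball 0 1, ENNReal.ofReal (h u) * ENNReal.ofReal (involutionJacobian u z) := by
  rw [involutionAverage, ofReal_integral_eq_lintegral_ofReal
    (integrableOn_mul_involutionJacobian hh hz)]
  · exact lintegral_congr fun u => ENNReal.ofReal_mul (h0 u)
  · filter_upwards [ae_restrict_mem measurableSet_ball] with u hu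
    exact mul_nonneg (h0 u) (involutionJacobian_nonneg (mem_ball_zero_iff.1 hu) z)

/-- By Tonelli's theorem, as each `J(u,·)` has integral equal to the volume of the ball. -/
lemma lintegral_involutionAverage_lt_top {h : CSpace n → ℝ} (hh : IntegrableOn h (ball 0 1))
    (h0 : ∀ u, 0 ≤ h u) :
    ∫⁻ z in ball 0 1, ENNReal.ofReal (involutionAverage h z) < ∞ := by
  have hm : AEMeasurable (Function.uncurry fun (z u : CSpace n) =>
      ENNReal.ofReal (h u) * ENNReal.ofReal (involutionJacobian u z))
      ((volume.restrict (ball 0 1)).prod (volume.restrict (ball 0 1))) := by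
    have h1 : AEMeasurable (fun x : CSpace n × CSpace n => ENNReal.ofReal (h x.2))
        ((volume.restrict (ball 0 1)).prod (volume.restrict (ball 0 1))) :=
      (AEMeasurable.ennreal_ofReal hh.aemeasurable).comp_snd
    have h2 : AEMeasurable
        (fun x : CSpace n × CSpace n => ENNReal.ofReal (involutionJacobian x.2 x.1))
        ((volume.restrict (ball 0 1)).prod (volume.restrict (ball 0 1))) := by
      rw [Measure.prod_restrict]
      refine AEMeasurable.ennreal_ofReal (ContinuousOn.aemeasurable ?_
        (measurableSet_ball.prod measurableSet_ball))
      exact continuousOn_involutionJacobian.comp (f := fun x : CSpace n × CSpace n => (x.2, x.1))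
        (by fun_prop) fun x hx => ⟨hx.2, hx.1⟩
    exact h1.mul h2
  calc ∫⁻ z in ball 0 1, ENNReal.ofReal (involutionAverage h z)
      = ∫⁻ z in ball 0 1, ∫⁻ u in ball 0 1,
          ENNReal.ofReal (h u) * ENNReal.ofReal (involutionJacobian u z) :=
        setLIntegral_congr_fun measurableSet_ball fun z hz =>
          ofReal_involutionAverage hh h0 (mem_ball_zero_iff.1 hz)
    _ = ∫⁻ u in ball 0 1, ∫⁻ z in ball 0 1,
          ENNReal.ofReal (h u) * ENNReal.ofReal (involutionJacobian u z) :=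
        lintegral_lintegral_swap hm
    _ = ∫⁻ u in ball 0 1, ENNReal.ofReal (h u) * volume (ball (0 : CSpace n) 1) := by
        refine setLIntegral_congr_fun measurableSet_ball fun u hu => ?_
        rw [lintegral_const_mul' _ _ ENNReal.ofReal_ne_top,
          lintegral_involutionJacobian (mem_ball_zero_iff.1 hu)]
    _ = (∫⁻ u in ball 0 1, ENNReal.ofReal (h u)) * volume (ball (0 : CSpace n) 1) :=
        lintegral_mul_const' _ _ measure_ball_lt_top.ne
    _ < ∞ := ENNReal.mul_lt_top hh.lintegral_lt_top measure_ball_lt_top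

lemma setIntegral_comp_involution_le {f : CSpace n → ℂ} (hf : ContinuousOn f (ball 0 1)) {p α : ℝ}
    (hp : 0 < p) (hα : -1 < α)
    (hfi : IntegrableOn (fun u => ‖f u‖ ^ p * (1 - ‖u‖ ^ 2) ^ α) (ball 0 1))
    {z : CSpace n} (hz : ‖z‖ < 1) :
    ∫ u in ball 0 (3 / 4), ‖f (ballInvolution z u)‖ ^ p ≤
      ((7 / 64) ^ (α + (n + 1)))⁻¹ * ((1 - ‖z‖ ^ 2) ^ α)⁻¹ *
        involutionAverage (fun u => max 0 (‖f u‖ ^ p * (1 - ‖u‖ ^ 2) ^ α)) z := by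
  -- Outside the ball the real power of a negative base may be negative; the maximum with `0` makes
  -- `h` nonnegative everywhere and changes nothing on the ball.
  set h : CSpace n → ℝ := fun u => max 0 (‖f u‖ ^ p * (1 - ‖u‖ ^ 2) ^ α) with hh
  have hhi : IntegrableOn h (ball 0 1) := (integrable_zero _ _ _).sup hfi
  have h0 : ∀ u, 0 ≤ h u := fun u => le_max_left _ _
  have hA := one_sub_sq_pos hz
  have hq : 0 ≤ α + (n + 1) := by
    have : (0 : ℝ) ≤ n := n.cast_nonneg
    linarith
  set c : ℝ := (7 / 64) ^ (α + (n + 1)) * (1 - ‖z‖ ^ 2) ^ α with hc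
  have hc0 : 0 < c := by positivity
  have hsub : ball (0 : CSpace n) (3 / 4) ⊆ ball 0 1 := ball_subset_ball (by norm_num)
  have hmaps := (bijOn_ballInvolution hz).mapsTo
  have hcont : ContinuousOn (fun u => ‖f (ballInvolution z u)‖ ^ p) (ball 0 1) := by
    refine ((hf.comp ?_ hmaps).norm).rpow_const fun _ _ => Or.inr hp.le
    exact fun u hu => (hasFDerivAt_ballInvolution hz
      (mem_ball_zero_iff.1 hu).le).continuousAt.continuousWithinAt
  have havg0 : 0 ≤ involutionAverage h z :=
    setIntegral_nonneg measurableSet_ball fun u hu =>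
      mul_nonneg (h0 u) (involutionJacobian_nonneg (mem_ball_zero_iff.1 hu) z)
  have key : ENNReal.ofReal c * ∫⁻ u in ball 0 (3 / 4),
      ENNReal.ofReal (‖f (ballInvolution z u)‖ ^ p) ≤ ENNReal.ofReal (involutionAverage h z) := by
    rw [ofReal_involutionAverage hhi h0 hz, lintegral_ball_eq_lintegral_involution hz,
      ← lintegral_const_mul' _ _ ENNReal.ofReal_ne_top]
    refine (setLIntegral_mono' measurableSet_ball fun u hu => ?_).trans (lintegral_mono_set hsub)
    have hu1 := mem_ball_zero_iff.1 (hsub hu)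
    have hu2 := mem_ball_zero_iff.1 hu
    have hm := norm_pos_iff.2 (one_sub_inner_ne_zero hz hu1.le)
    rw [← ENNReal.ofReal_mul hc0.le, ← ENNReal.ofReal_mul (h0 _),
      ← ENNReal.ofReal_mul (involutionJacobian_nonneg hz _)]
    refine ENNReal.ofReal_le_ofReal ?_
    -- For `|u| < 3/4` the numerator is at least `7/16`, and the denominator is at most `2² = 4`.
    have hle : (7 / 64 : ℝ) ≤ (1 - ‖u‖ ^ 2) / ‖1 - inner ℂ z u‖ ^ 2 := by
      have h1 : ‖1 - inner ℂ z u‖ ≤ 2 := by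
        have h2 := norm_sub_le (1 : ℂ) (inner ℂ z u)
        have h3 : ‖inner ℂ z u‖ ≤ ‖z‖ * ‖u‖ := norm_inner_le_norm z u
        rw [norm_one] at h2
        nlinarith [norm_nonneg z, norm_nonneg u]
      rw [le_div_iff₀ (by positivity)]
      nlinarith [norm_nonneg u]
    calc c * ‖f (ballInvolution z u)‖ ^ p
        ≤ (1 - ‖z‖ ^ 2) ^ α * ((1 - ‖u‖ ^ 2) / ‖1 - inner ℂ z u‖ ^ 2) ^ (α + (n + 1)) *
          ‖f (ballInvolution z u)‖ ^ p := by
          rw [hc, mul_comm ((7 / 64 : ℝ) ^ _)]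
          gcongr
      _ = ‖f (ballInvolution z u)‖ ^ p * (involutionJacobian z u *
            ((1 - ‖ballInvolution z u‖ ^ 2) ^ α *
              involutionJacobian (ballInvolution z u) z)) := by
          rw [involutionJacobian_mul hz hu1, mul_comm]
      _ = involutionJacobian z u * (‖f (ballInvolution z u)‖ ^ p *
            (1 - ‖ballInvolution z u‖ ^ 2) ^ α *
              involutionJacobian (ballInvolution z u) z) := by ring
      _ ≤ _ := by
          have h1 := involutionJacobian_nonneg hz u
          have h2 := involutionJacobian_nonneg (norm_ballInvolution_lt_one hz hu1) z
          gcongr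
          exact le_max_right _ _
  rw [integral_eq_lintegral_of_nonneg_ae (ae_of_all _ fun _ => by positivity)
    ((hcont.mono hsub).aestronglyMeasurable measurableSet_ball)]
  have h5 := ENNReal.toReal_mono ENNReal.ofReal_ne_top key
  rw [ENNReal.toReal_mul, ENNReal.toReal_ofReal hc0.le, ENNReal.toReal_ofReal havg0] at h5
  rw [← mul_inv, ← hc, inv_mul_eq_div, le_div_iff₀ hc0, mul_comm]
  exact h5

end Average

/-! ### Comparison of metrics and the equivalences. -/

section Equivalence

open scoped ENNReal

variable {n : ℕ}

lemma pseudoHyp_nonneg (z w : CSpace n) : 0 ≤ pseudoHyp z w := norm_nonneg _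

lemma pseudoHyp_lt_one {z w : CSpace n} (hz : ‖z‖ < 1) (hw : ‖w‖ < 1) : pseudoHyp z w < 1 :=
  norm_ballInvolution_lt_one hz hw

/-- The left side is the first term of the power series of the right side, whose terms are
nonnegative. -/
lemma le_half_log_div {x : ℝ} (h0 : 0 ≤ x) (h1 : x < 1) :
    x ≤ 1 / 2 * Real.log ((1 + x) / (1 - x)) := by
  have h := Real.hasSum_log_sub_log_of_abs_lt_one (x := x) (by rwa [abs_of_nonneg h0])
  have h2 := le_hasSum h 0 fun k _ => by positivity
  rw [Real.log_div (by linarith) (by linarith)]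
  norm_num at h2
  linarith

lemma pseudoHyp_le_bergmanDist {z w : CSpace n} (hz : ‖z‖ < 1) (hw : ‖w‖ < 1) :
    pseudoHyp z w ≤ bergmanDist z w :=
  le_half_log_div (pseudoHyp_nonneg z w) (pseudoHyp_lt_one hz hw)

lemma bergmanDist_le {z w : CSpace n} {κ : ℝ} (h : pseudoHyp z w ≤ κ) (hκ : κ < 1) :
    bergmanDist z w ≤ 1 / 2 * Real.log ((1 + κ) / (1 - κ)) := by
  have h0 := pseudoHyp_nonneg z w
  unfold bergmanDist
  change 1 / 2 * Real.log ((1 + pseudoHyp z w) / (1 - pseudoHyp z w)) ≤ _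
  have h1 : 0 < 1 - pseudoHyp z w := by linarith
  have h2 : 0 < 1 - κ := by linarith
  have h3 : 0 ≤ 1 + κ := by linarith
  gcongr

lemma pseudoHyp_le_div_left {z w : CSpace n} (hz : ‖z‖ < 1) (hw : ‖w‖ < 1) :
    pseudoHyp z w ≤ ‖z - w‖ / (1 - ‖z‖) :=
  (norm_ballInvolution_le hz hw.le).trans
    (div_le_div_of_nonneg_left (norm_nonneg _) (by linarith) (one_sub_norm_le hw.le))

lemma pseudoHyp_le_div_right {z w : CSpace n} (hz : ‖z‖ < 1) (hw : ‖w‖ < 1) :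
    pseudoHyp z w ≤ ‖z - w‖ / (1 - ‖w‖) := by
  refine (norm_ballInvolution_le hz hw.le).trans
    (div_le_div_of_nonneg_left (norm_nonneg _) (by linarith) ?_)
  rw [norm_one_sub_inner_symm]
  exact one_sub_norm_le hz.le

lemma enorm_rpow_eq_ofReal {E : Type*} [NormedAddCommGroup E] (x : E) {p : ℝ} (hp : 0 ≤ p) :
    ‖x‖ₑ ^ p = ENNReal.ofReal (‖x‖ ^ p) := by
  rw [← ofReal_norm, ENNReal.ofReal_rpow_of_nonneg (norm_nonneg x) hp]

lemma lintegral_rpow_mul_lt_top {g G : CSpace n → ℝ} {p c : ℝ} (hp : 0 ≤ p) (hc : 0 ≤ c)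
    {V W : CSpace n → ℝ}
    (hle : ∀ z ∈ ball (0 : CSpace n) 1, ‖G z‖ ^ p * V z ≤ c * (‖g z‖ ^ p * W z))
    (hg : ∫⁻ z in ball 0 1, ‖g z‖ₑ ^ p * ENNReal.ofReal (W z) < ∞) :
    ∫⁻ z in ball 0 1, ‖G z‖ₑ ^ p * ENNReal.ofReal (V z) < ∞ := by
  calc _ ≤ ∫⁻ z in ball 0 1, ENNReal.ofReal c * (‖g z‖ₑ ^ p * ENNReal.ofReal (W z)) := by
        refine setLIntegral_mono' measurableSet_ball fun z hz => ?_
        rw [enorm_rpow_eq_ofReal _ hp, enorm_rpow_eq_ofReal _ hp,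
          ← ENNReal.ofReal_mul (by positivity), ← ENNReal.ofReal_mul (by positivity),
          ← ENNReal.ofReal_mul hc]
        exact ENNReal.ofReal_le_ofReal (hle z hz)
    _ = ENNReal.ofReal c * ∫⁻ z in ball 0 1, ‖g z‖ₑ ^ p * ENNReal.ofReal (W z) :=
        lintegral_const_mul' _ _ ENNReal.ofReal_ne_top
    _ < ∞ := ENNReal.mul_lt_top ENNReal.ofReal_lt_top hg

/-- The local supremum of a function in the Bergman space is controlled by a continuous function
in the corresponding weighted `L^p` space. -/
lemma exists_continuousOn_pseudoHyp_bound {p α : ℝ} (hp : 0 < p) (hα : -1 < α) {f : CSpace n → ℂ}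
    (hf : DifferentiableOn ℂ f (ball 0 1))
    (hfp : ∫⁻ z in ball 0 1, ‖f z‖ₑ ^ p * ENNReal.ofReal ((1 - ‖z‖ ^ 2) ^ α) < ∞) :
    ∃ g : CSpace n → ℝ, ContinuousOn g (ball 0 1) ∧
      ∫⁻ z in ball 0 1, ‖g z‖ₑ ^ p * ENNReal.ofReal ((1 - ‖z‖ ^ 2) ^ α) < ∞ ∧
      ∀ z ∈ ball 0 1, ∀ w ∈ ball 0 1, ‖f z - f w‖ ≤ pseudoHyp z w * (g z + g w) := by
  have hwc : ∀ β : ℝ, ContinuousOn (fun z : CSpace n => (1 - ‖z‖ ^ 2) ^ β) (ball 0 1) := fun β => by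
    refine (by fun_prop : Continuous fun z : CSpace n => 1 - ‖z‖ ^ 2).continuousOn.rpow_const
      fun z hz => Or.inl ?_
    exact (one_sub_sq_pos (mem_ball_zero_iff.1 hz)).ne'
  have hfi : IntegrableOn (fun u => ‖f u‖ ^ p * (1 - ‖u‖ ^ 2) ^ α) (ball 0 1) := by
    refine ⟨ContinuousOn.aestronglyMeasurable ?_ measurableSet_ball, ?_⟩
    · exact (hf.continuousOn.norm.rpow_const fun _ _ => Or.inr hp.le).mul (hwc α)
    · rw [HasFiniteIntegral]
      refine lt_of_eq_of_lt (setLIntegral_congr_fun measurableSet_ball fun u hu => ?_) hfp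
      have := one_sub_sq_pos (mem_ball_zero_iff.1 hu)
      rw [enorm_rpow_eq_ofReal _ hp.le, ← ENNReal.ofReal_mul (by positivity),
        Real.enorm_of_nonneg (by positivity)]
  set h : CSpace n → ℝ := fun u => max 0 (‖f u‖ ^ p * (1 - ‖u‖ ^ 2) ^ α) with hh
  have hhi : IntegrableOn h (ball 0 1) := (integrable_zero _ _ _).sup hfi
  have h0 : ∀ u, 0 ≤ h u := fun u => le_max_left _ _
  have havg0 : ∀ z ∈ ball (0 : CSpace n) 1, 0 ≤ involutionAverage h z := fun z _ =>
    setIntegral_nonneg measurableSet_ball fun u hu =>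
      mul_nonneg (h0 u) (involutionJacobian_nonneg (mem_ball_zero_iff.1 hu) z)
  obtain ⟨C, hC, hsup⟩ := exists_norm_rpow_le_integral n hp
  set c : ℝ := C * ((7 / 64) ^ (α + (n + 1)))⁻¹ with hc
  have hc0 : 0 < c := by positivity
  set B : CSpace n → ℝ := fun z => c * ((1 - ‖z‖ ^ 2) ^ (-α) * involutionAverage h z) with hB
  have hB0 : ∀ z ∈ ball (0 : CSpace n) 1, 0 ≤ B z := fun z hz => by
    have := one_sub_sq_pos (mem_ball_zero_iff.1 hz)
    have := havg0 z hz
    positivity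
  set A : CSpace n → ℝ := fun z => B z ^ p⁻¹ with hA
  have hA0 : ∀ z ∈ ball (0 : CSpace n) 1, 0 ≤ A z := fun z hz => Real.rpow_nonneg (hB0 z hz) _
  have hbd : ∀ z ∈ ball (0 : CSpace n) 1, DifferentiableOn ℂ (f ∘ ballInvolution z) (ball 0 1) ∧
      ∀ u : CSpace n, ‖u‖ ≤ 1 / 2 → ‖(f ∘ ballInvolution z) u‖ ≤ A z := by
    intro z hz
    have hz1 := mem_ball_zero_iff.1 hz
    have hd : DifferentiableOn ℂ (f ∘ ballInvolution z) (ball 0 1) := by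
      refine hf.comp (fun u hu => ?_) (bijOn_ballInvolution hz1).mapsTo
      exact (hasFDerivAt_ballInvolution hz1
        (mem_ball_zero_iff.1 hu).le).differentiableAt.differentiableWithinAt
    refine ⟨hd, fun u hu => ?_⟩
    have h1 := hsup _ hd u hu
    have h2 := setIntegral_comp_involution_le hf.continuousOn hp hα hfi hz1
    have h3 : ‖(f ∘ ballInvolution z) u‖ ^ p ≤ B z := by
      calc _ ≤ C * (((7 / 64) ^ (α + (n + 1)))⁻¹ * ((1 - ‖z‖ ^ 2) ^ α)⁻¹ *
            involutionAverage h z) := h1.trans (by gcongr; exact h2)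
        _ = B z := by
          rw [hB]
          simp only
          rw [Real.rpow_neg (one_sub_sq_pos hz1).le, hc]
          ring
    rw [hA]
    exact (Real.le_rpow_inv_iff_of_pos (norm_nonneg _) (hB0 z hz) hp).2 h3
  refine ⟨fun z => 4 * A z, ?_, ?_, ?_⟩
  · refine continuousOn_const.mul (ContinuousOn.rpow_const ?_ fun _ _ => Or.inr (by positivity))
    exact continuousOn_const.mul ((hwc _).mul (continuousOn_involutionAverage hhi))
  · have : ∀ z ∈ ball (0 : CSpace n) 1, ‖4 * A z‖ₑ ^ p * ENNReal.ofReal ((1 - ‖z‖ ^ 2) ^ α) =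
        ENNReal.ofReal (4 ^ p * c) * ENNReal.ofReal (involutionAverage h z) := by
      intro z hz
      have h1 := one_sub_sq_pos (mem_ball_zero_iff.1 hz)
      rw [enorm_rpow_eq_ofReal _ hp.le, ← ENNReal.ofReal_mul (by positivity),
        ← ENNReal.ofReal_mul (by positivity), Real.norm_of_nonneg
          (mul_nonneg (by norm_num) (hA0 z hz)), Real.mul_rpow (by norm_num) (hA0 z hz), hA]
      simp only
      rw [Real.rpow_inv_rpow (hB0 z hz) hp.ne', hB]
      simp only
      have h2 : (1 - ‖z‖ ^ 2) ^ (-α) * (1 - ‖z‖ ^ 2) ^ α = 1 := by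
        rw [← Real.rpow_add h1]; simp
      congr 1
      linear_combination 4 ^ p * c * involutionAverage h z * h2
    rw [setLIntegral_congr_fun measurableSet_ball this,
      lintegral_const_mul' _ _ ENNReal.ofReal_ne_top]
    exact ENNReal.mul_lt_top ENNReal.ofReal_lt_top (lintegral_involutionAverage_lt_top hhi h0)
  · intro z hz w hw
    have hz1 := mem_ball_zero_iff.1 hz
    have hw1 := mem_ball_zero_iff.1 hw
    have hself : ∀ v ∈ ball (0 : CSpace n) 1, ‖f v‖ ≤ A v := fun v hv => by
      have := (hbd v hv).2 0 (by simp)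
      rwa [Function.comp_apply, ballInvolution_zero (mem_ball_zero_iff.1 hv)] at this
    have hz2 := hA0 z hz
    have hw2 := hA0 w hw
    have hρ := pseudoHyp_nonneg z w
    -- Near points use the Schwarz lemma; for far points `4ρ ≥ 2`, so the size bound `|f| ≤ A` is
    -- enough.
    rcases lt_or_ge (pseudoHyp z w) (1 / 2) with h1 | h1
    · have h2 := norm_sub_le_of_bounded (hbd z hz).1 (hbd z hz).2 h1
      rw [Function.comp_apply, Function.comp_apply, ballInvolution_zero hz1,
        ballInvolution_ballInvolution hz1 hw1.le, norm_sub_rev] at h2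
      calc ‖f z - f w‖ ≤ 4 * A z * pseudoHyp z w := h2
        _ ≤ _ := by nlinarith
    · calc ‖f z - f w‖ ≤ ‖f z‖ + ‖f w‖ := norm_sub_le _ _
        _ ≤ A z + A w := add_le_add (hself z hz) (hself w hw)
        _ ≤ _ := by nlinarith

/-- Control of the radial differences of `f` gives membership in the Bergman space. -/
lemma memLp_of_radial_bound {p α K : ℝ} (hp : 0 < p) (hα : -1 < α) (hK : 1 < K)
    (hKα : (3 : ℝ) ^ p * K ^ (-(1 + α)) ≤ 1 / 2) {f : CSpace n → ℂ} {G : CSpace n → ℝ}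
    (hf : ContinuousOn f (ball 0 1)) (hG : ContinuousOn G (ball 0 1))
    (hle : ∀ z w : CSpace n, ∀ t : ℝ, 0 < t → ‖z‖ = 1 - t → ‖w‖ = 1 - K * t → w ∈ ball 0 1 →
      z ∈ ball 0 1 → ‖z - w‖ = (K - 1) * t → ‖f z - f w‖ ≤ G z + G w)
    (hGp : ∫⁻ z in ball 0 1, ‖G z‖ₑ ^ p * ENNReal.ofReal ((1 - ‖z‖) ^ α) < ∞) :
    MemLp f (ENNReal.ofReal p) (weightedVolume n α) := by
  rw [memLp_weightedVolume_iff hp hα hf, lintegral_ball_weight_lt_top_iff]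
  refine lintegral_ball_rpow_lt_top hp hα hK hKα hf hG (fun σ hσ t ht0 ht1 => ?_) hGp
  have hK0 : 0 < K := one_pos.trans hK
  have hKt : K * t < 1 / 2 := by rwa [lt_div_iff₀ hK0, mul_comm] at ht1
  have htt : t < K * t := lt_mul_of_one_lt_left ht0 hK
  have hn : ∀ r : ℝ, 0 ≤ r → ‖r • σ‖ = r := fun r hr => by
    rw [norm_smul, hσ, mul_one, Real.norm_of_nonneg hr]
  have hz := hn (1 - t) (by linarith)
  have hw := hn (1 - K * t) (by linarith)
  have h := hle _ _ t ht0 hz hw (by rw [mem_ball_zero_iff, hw]; linarith)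
    (by rw [mem_ball_zero_iff, hz]; linarith) (by
      rw [← sub_smul, hn] <;> linarith)
  have := norm_le_norm_add_norm_sub' (f ((1 - t) • σ)) (f ((1 - K * t) • σ))
  linarith

end Equivalence

theorem theorem13 (n : ℕ) (p α : ℝ) (hp : 0 < p) (hα : -1 < α)
    (f : CSpace n → ℂ) (hf : DifferentiableOn ℂ f (unitBall n)) :
    List.TFAE [
      MemBergman n p α f,
      ∃ g : CSpace n → ℝ, ContinuousOn g (unitBall n) ∧
        MemLp g (ENNReal.ofReal p) (weightedVolume n α) ∧
        ∀ z ∈ unitBall n, ∀ w ∈ unitBall n, ‖f z - f w‖ ≤ pseudoHyp z w * (g z + g w),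
      ∃ g : CSpace n → ℝ, ContinuousOn g (unitBall n) ∧
        MemLp g (ENNReal.ofReal p) (weightedVolume n α) ∧
        ∀ z ∈ unitBall n, ∀ w ∈ unitBall n, ‖f z - f w‖ ≤ bergmanDist z w * (g z + g w),
      ∃ g : CSpace n → ℝ, ContinuousOn g (unitBall n) ∧
        MemLp g (ENNReal.ofReal p) (weightedVolume n (p + α)) ∧
        ∀ z ∈ unitBall n, ∀ w ∈ unitBall n, ‖f z - f w‖ ≤ ‖z - w‖ * (g z + g w)] := by
  have hpα : -1 < p + α := by linarith
  obtain ⟨K, hK, hKα⟩ := exists_hardy_factor (p := p) hα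
  have hK0 : 0 < K := one_pos.trans hK
  simp only [unitBall] at hf ⊢
  tfae_have 1 → 2 := by
    rintro ⟨-, h⟩
    rw [memLp_weightedVolume_iff hp hα hf.continuousOn] at h
    obtain ⟨g, hg, hgp, hfg⟩ := exists_continuousOn_pseudoHyp_bound hp hα hf h
    exact ⟨g, hg, (memLp_weightedVolume_iff hp hα hg).2 hgp, hfg⟩
  tfae_have 2 → 3 := by
    rintro ⟨g, hg, hgp, hfg⟩
    -- Enlarging `ρ` to `β` needs a nonnegative second factor, and `g` may take negative values.
    refine ⟨fun z => |g z|, hg.abs, hgp.norm, fun z hz w hw => ?_⟩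
    calc ‖f z - f w‖ ≤ pseudoHyp z w * (g z + g w) := hfg z hz w hw
      _ ≤ pseudoHyp z w * (|g z| + |g w|) := by
        have := pseudoHyp_nonneg z w
        gcongr <;> exact le_abs_self _
      _ ≤ _ := by
        gcongr
        exact pseudoHyp_le_bergmanDist (mem_ball_zero_iff.1 hz) (mem_ball_zero_iff.1 hw)
  tfae_have 2 → 4 := by
    rintro ⟨g, hg, hgp, hfg⟩
    -- Dividing by `1-|z|` is what the change of weight from `α` to `p+α` compensates.
    have hG : ContinuousOn (fun z : CSpace n => |g z| / (1 - ‖z‖)) (ball 0 1) :=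
      hg.abs.div (by fun_prop) fun z hz => by
        rw [mem_ball_zero_iff] at hz
        linarith
    refine ⟨_, hG, (memLp_weightedVolume_iff hp hpα hG).2 ?_, fun z hz w hw => ?_⟩
    · rw [memLp_weightedVolume_iff hp hα hg, lintegral_ball_weight_lt_top_iff] at hgp
      rw [lintegral_ball_weight_lt_top_iff]
      refine lintegral_rpow_mul_lt_top hp.le zero_le_one (fun z hz => ?_) hgp
      rw [mem_ball_zero_iff] at hz
      have h1 : 0 < 1 - ‖z‖ := by linarith
      rw [Real.norm_of_nonneg (by positivity), Real.div_rpow (abs_nonneg _) h1.le,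
        Real.rpow_add h1, Real.norm_eq_abs, one_mul]
      apply le_of_eq
      have : (1 - ‖z‖) ^ p ≠ 0 := (Real.rpow_pos_of_pos h1 p).ne'
      field_simp
    · have hz1 := mem_ball_zero_iff.1 hz
      have hw1 := mem_ball_zero_iff.1 hw
      calc ‖f z - f w‖ ≤ pseudoHyp z w * (g z + g w) := hfg z hz w hw
        _ ≤ pseudoHyp z w * (|g z| + |g w|) := by
          have := pseudoHyp_nonneg z w
          gcongr <;> exact le_abs_self _
        _ = pseudoHyp z w * |g z| + pseudoHyp z w * |g w| := mul_add _ _ _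
        _ ≤ ‖z - w‖ / (1 - ‖z‖) * |g z| + ‖z - w‖ / (1 - ‖w‖) * |g w| := by
          gcongr
          · exact pseudoHyp_le_div_left hz1 hw1
          · exact pseudoHyp_le_div_right hz1 hw1
        _ = _ := by ring
  tfae_have 3 → 1 := by
    rintro ⟨g, hg, hgp, hfg⟩
    refine ⟨hf, ?_⟩
    rw [memLp_weightedVolume_iff hp hα hg, lintegral_ball_weight_lt_top_iff] at hgp
    -- The two points on a ray satisfy `|z-w|/(1-|w|) = (K-1)t/(Kt)`, so their Bergman distance is
    -- bounded independently of `t`.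
    set κ : ℝ := (K - 1) / K with hκ
    have hκ1 : κ < 1 := by rw [hκ, div_lt_one hK0]; linarith
    have hκ0 : 0 ≤ κ := div_nonneg (by linarith) hK0.le
    set b : ℝ := 1 / 2 * Real.log ((1 + κ) / (1 - κ)) with hb
    have hb0 : 0 ≤ b := hκ0.trans (le_half_log_div hκ0 hκ1)
    refine memLp_of_radial_bound hp hα hK hKα (G := fun z => b * |g z|) hf.continuousOn
      (continuousOn_const.mul hg.abs) (fun z w t ht hzt hwt hw hz hzw => ?_)
      (lintegral_rpow_mul_lt_top (c := b ^ p) hp.le (by positivity) (fun z hz => ?_) hgp)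
    · have hz1 := mem_ball_zero_iff.1 hz
      have hw1 := mem_ball_zero_iff.1 hw
      have hρ : pseudoHyp z w ≤ κ := by
        refine (pseudoHyp_le_div_right hz1 hw1).trans_eq ?_
        rw [hzw, hwt, sub_sub_cancel, mul_div_mul_right _ _ ht.ne']
      have hβ0 : 0 ≤ bergmanDist z w :=
        (pseudoHyp_nonneg z w).trans (pseudoHyp_le_bergmanDist hz1 hw1)
      calc ‖f z - f w‖ ≤ bergmanDist z w * (g z + g w) := hfg z hz w hw
        _ ≤ bergmanDist z w * (|g z| + |g w|) := by gcongr <;> exact le_abs_self _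
        _ ≤ b * (|g z| + |g w|) := by gcongr; exact bergmanDist_le hρ hκ1
        _ = _ := mul_add _ _ _
    · rw [norm_mul, Real.norm_of_nonneg hb0, Real.mul_rpow hb0 (norm_nonneg _), norm_abs_eq_norm,
        mul_assoc]
  tfae_have 4 → 1 := by
    rintro ⟨g, hg, hgp, hfg⟩
    refine ⟨hf, ?_⟩
    rw [memLp_weightedVolume_iff hp hpα hg, lintegral_ball_weight_lt_top_iff] at hgp
    -- Here `|z-w| = (K-1)t` is at most `K` times `1-|z| = t` and also `K` times `1-|w| = Kt`; the
    -- factor `1-|z|` then lowers the weight exponent from `p+α` to `α`.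
    refine memLp_of_radial_bound hp hα hK hKα (G := fun z => K * ((1 - ‖z‖) * |g z|))
      hf.continuousOn (continuousOn_const.mul (ContinuousOn.mul (by fun_prop) hg.abs))
      (fun z w t ht hzt hwt hw hz hzw => ?_)
      (lintegral_rpow_mul_lt_top (c := K ^ p) hp.le (by positivity) (fun z hz => ?_) hgp)
    · have h1 : t ≤ K * t := le_mul_of_one_le_left ht.le hK.le
      have h2 : (K - 1) * t ≤ K * t := by linarith
      have h3 : (K - 1) * t ≤ K * (K * t) := by nlinarith
      calc ‖f z - f w‖ ≤ ‖z - w‖ * (g z + g w) := hfg z hz w hw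
        _ ≤ ‖z - w‖ * (|g z| + |g w|) := by gcongr <;> exact le_abs_self _
        _ = (K - 1) * t * |g z| + (K - 1) * t * |g w| := by rw [hzw, mul_add]
        _ ≤ K * t * |g z| + K * (K * t) * |g w| := by gcongr
        _ = K * ((1 - ‖z‖) * |g z|) + K * ((1 - ‖w‖) * |g w|) := by rw [hzt, hwt]; ring
    · rw [mem_ball_zero_iff] at hz
      have h1 : 0 < 1 - ‖z‖ := by linarith
      rw [Real.norm_of_nonneg (by positivity), Real.mul_rpow hK0.le (by positivity),
        Real.mul_rpow h1.le (abs_nonneg _), Real.rpow_add h1, Real.norm_eq_abs]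
      apply le_of_eq
      ring
  tfae_finish
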